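/- Let $\mathcal T$ be a rigidly-compactly generated tensor triangulated category: a triangulated category with set-indexed coproducts, generated by a set of compact objects (no proper localising subcategory contains them), with a closed symmetric monoidal structure $(\otimes,\mathbb 1)$ whose tensor product is exact in each variable, such that $\mathbb 1$ is compact and every compact object $x$ is dualisable (the natural map $\mathcal Hom(x,\mathbb 1)\otimes y\to\mathcal Hom(x,y)$ is an isomorphism for all $y$). Let $\mathcal T^c$ be the full subcategory of compact objects and let $X=\operatorname{Spc}\mathcal T^c$ be its Balmer spectrum, i.e. the set of prime thick tensor ideals of $\mathcal T^c$, with the Zariski topology generated by the sets $\{\mathcal P\mid x\in\mathcal P\}$, $x\in\mathcal T^c$. A subset of $X$ is Thomason if it is a union of subsets whose complements are quasi-compact and Zariski open; the Thomason subsets are the open sets of the Hochster dual space $X^\vee$. Assume that each point of $X^\vee$ is locally closed, i.e. for each $p\in X$ there are Thomason subsets $U,V$ with $V\smallsetminus U=\{p\}$. For $V\subseteq X$ Thomason let $\mathcal T_V$ be the localising subcategory of $\mathcal T$ generated by all $x\in\mathcal T^c$ with $\{\mathcal P\in X\mid x\notin\mathcal P\}\subseteq V$. For each $x\in\mathcal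 T$ there is an exact triangle $\Gamma_V(x)\to x\to L_V(x)\to\Sigma\Gamma_V(x)$, unique up to isomorphism, with $\Gamma_V(x)\in\mathcal T_V$ and $L_V(x)\in(\mathcal T_V)^\perp=\{y\mid\operatorname{Hom}(s,y)=0\text{ for all }s\in\mathcal T_V\}$. For $p\in X$ with $\{p\}=V\smallsetminus U$ as above set $\Gamma_p=\Gamma_V\circ L_U$ and $\mathcal T_{\{p\}}=\mathcal T_V\cap(\mathcal T_U)^\perp$; up to isomorphism these do not depend on $U,V$. For $x\in\mathcal T$ let $\operatorname{supp}_\otimes(x)=\{p\in X\mid\Gamma_p(x)\ne0\}$. A localising tensor ideal is a localising subcategory $\mathcal S\subseteq\mathcal T$ with $x\otimes y\in\mathcal S$ for all $x\in\mathcal T$, $y\in\mathcal S$; let $\operatorname{Loc}_\otimes(\mathcal T)$ be the lattice of these, ordered by inclusion, $\operatorname{loc}_\otimes(x)$ the smallest one containing $x$, and $\operatorname{supp}_\otimes(\mathcal S)=\bigcup_{x\in\mathcal S}\operatorname{supp}_\otimes(x)$. Then the following are equivalent. (1) $\mathcal T$ is stratified via $\operatorname{Spc}\mathcal T^c$. That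 is, (a) every localising tensor ideal $\mathcal S$ satisfies $\mathcal S=\bigvee_{p\in X}\Gamma_p\mathcal S$, where $\Gamma_p\mathcal S$ consists of the objects isomorphic to $\Gamma_p(x)$ for some $x\in\mathcal S$, and the join is the smallest localising subcategory containing all $\Gamma_p\mathcal S$; and (b) for every $p\in X$, every localising tensor ideal of $\mathcal T$ contained in $\mathcal T_{\{p\}}$ is either zero or equal to $\mathcal T_{\{p\}}$. (2) The map $\mathcal S\mapsto\operatorname{supp}_\otimes(\mathcal S)$ is a lattice isomorphism from $\operatorname{Loc}_\otimes(\mathcal T)$ onto the power set of $\operatorname{Spc}\mathcal T^c$. (3) For all $x,y\in\mathcal T$, $\operatorname{supp}_\otimes(x)\subseteq\operatorname{supp}_\otimes(y)$ implies $\operatorname{loc}_\otimes(x)\subseteq\operatorname{loc}_\otimes(y)$. -/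

import Mathlib

open CategoryTheory CategoryTheory.Limits CategoryTheory.Pretriangulated
  CategoryTheory.MonoidalCategory

universe v u

namespace TTG

section Triangulated

/-- An exact functor between triangulated categories: it commutes with the suspension, and it sends
exact triangles to exact triangles. -/
def IsExact {C D : Type*} [Category* C] [HasZeroObject C] [Preadditive C] [HasShift C ℤ]
    [∀ n : ℤ, (shiftFunctor C n).Additive] [Pretriangulated C]
    [Category* D] [HasZeroObject D] [Preadditive D] [HasShift D ℤ]
    [∀ n : ℤ, (shiftFunctor D n).Additive] [Pretriangulated D] (F : C ⥤ D) : Prop :=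
  ∃ _ : F.CommShift ℤ, F.IsTriangulated

variable {T : Type u} [Category.{v} T] [HasZeroObject T] [Preadditive T] [HasShift T ℤ]
  [∀ n : ℤ, (shiftFunctor T n).Additive] [Pretriangulated T] [HasCoproducts.{v} T]

/-- Compact objects: every morphism into a coproduct factors through a finite subcoproduct. -/
def Compact : ObjectProperty T := fun x =>
  ∀ (ι : Type v) (y : ι → T) (φ : x ⟶ ∐ y), ∃ (J : Finset ι) (ψ : x ⟶ ∐ fun j : J => y j),
    ψ ≫ Sigma.desc (fun j : J => Sigma.ι y j) = φ

/-- Localising subcategories: full (replete) triangulated subcategories closed under all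
set-indexed coproducts. -/
structure IsLocalising (S : ObjectProperty T) : Prop where
  triangulated : S.IsTriangulated
  iso : S.IsClosedUnderIsomorphisms
  coprod : ∀ (ι : Type v) (y : ι → T), (∀ i, S (y i)) → S (∐ y)

/-- The smallest localising subcategory containing a class of objects. -/
def loc (X : ObjectProperty T) : ObjectProperty T :=
  fun x => ∀ S : ObjectProperty T, IsLocalising S → X ≤ S → S x

/-- `T` is compactly generated: there is a set of compact objects that is not contained in any
proper localising subcategory. -/
def IsCompactlyGenerated (T : Type u) [Category.{v} T] [HasZeroObject T] [Preadditive T]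
    [HasShift T ℤ] [∀ n : ℤ, (shiftFunctor T n).Additive] [Pretriangulated T]
    [HasCoproducts.{v} T] : Prop :=
  ∃ (ι : Type v) (G : ι → T), (∀ i, Compact (G i)) ∧
    ∀ S : ObjectProperty T, IsLocalising S → (∀ i, S (G i)) → ∀ x, S x

/-- There is an exact triangle `a ⟶ x ⟶ b ⟶ a⟦1⟧` with `a` in `S` and `b` in `S^⊥`. For a
localising subcategory `S` the objects `a` and `b` are, up to isomorphism, determined by `x`:
they are the values `a = Γ_S x` and `b = L_S x` of the right adjoint of the inclusion of `S`,
and of the localisation functor with kernel `S`. -/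
def IsLocalisationTriangle (S : ObjectProperty T) (a x b : T) : Prop :=
  S a ∧ S.rightOrthogonal b ∧
    ∃ (f : a ⟶ x) (g : x ⟶ b) (h : b ⟶ a⟦(1 : ℤ)⟧), Triangle.mk f g h ∈ distTriang T

end Triangulated

section TensorTriangulated

variable {T : Type u} [Category.{v} T] [HasZeroObject T] [Preadditive T] [HasShift T ℤ]
  [∀ n : ℤ, (shiftFunctor T n).Additive] [Pretriangulated T] [HasCoproducts.{v} T]
  [MonoidalCategory T]

/-- The natural map `hom(x, 𝟙) ⊗ y ⟶ hom(x, y)`, adjoint to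
`x ⊗ (hom(x, 𝟙) ⊗ y) ≅ (x ⊗ hom(x, 𝟙)) ⊗ y ⟶ 𝟙 ⊗ y ≅ y`. -/
noncomputable def dualTensorMap [MonoidalClosed T] (x y : T) :
    (ihom x).obj (𝟙_ T) ⊗ y ⟶ (ihom x).obj y :=
  MonoidalClosed.curry
    ((α_ x ((ihom x).obj (𝟙_ T)) y).inv ≫ ((ihom.ev x).app (𝟙_ T)) ▷ y ≫ (λ_ y).hom)

/-- Dualisable (rigid) objects. -/
def Dualisable [MonoidalClosed T] (x : T) : Prop := ∀ y : T, IsIso (dualTensorMap x y)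

/-- A (closed symmetric monoidal, triangulated) category `T` with coproducts is a
rigidly-compactly generated tensor triangulated category. -/
structure IsRigidlyCompactlyGenerated (T : Type u) [Category.{v} T] [HasZeroObject T]
    [Preadditive T] [HasShift T ℤ] [∀ n : ℤ, (shiftFunctor T n).Additive] [Pretriangulated T]
    [HasCoproducts.{v} T] [MonoidalCategory T] [MonoidalClosed T] : Prop where
  tensorLeft_exact : ∀ x : T, IsExact (tensorLeft x)
  tensorRight_exact : ∀ x : T, IsExact (tensorRight x)
  compactlyGenerated : IsCompactlyGenerated T
  compact_unit : Compact (𝟙_ T)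
  dualisable : ∀ x : T, Compact x → Dualisable x

/-- Localising tensor ideals of `T`. -/
structure IsLocalisingIdeal (S : ObjectProperty T) : Prop extends IsLocalising S where
  tensor : ∀ x y : T, S y → S (x ⊗ y)

variable (T) in
/-- `Loc_⊗(T)`: the localising tensor ideals of `T`, ordered by inclusion. -/
abbrev LocIdeal := {S : ObjectProperty T // IsLocalisingIdeal S}

/-- The smallest localising tensor ideal containing an object. -/
def locTensor (x : T) : ObjectProperty T :=
  fun y => ∀ S : ObjectProperty T, IsLocalisingIdeal S → S x → S y

variable (T) in
/-- The Balmer spectrum `Spc T^c`: the prime thick tensor ideals of the category `T^c` of compact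
objects. A full subcategory of `T^c` is represented by the property of objects of `T` of being
compact and lying in the subcategory. -/
@[ext]
structure Spc where
  carrier : ObjectProperty T
  le_compact : carrier ≤ Compact
  triangulated : carrier.IsTriangulated
  retracts : carrier.IsStableUnderRetracts
  tensor : ∀ x y : T, Compact x → carrier y → carrier (x ⊗ y)
  proper : ∃ x : T, Compact x ∧ ¬ carrier x
  prime : ∀ x y : T, Compact x → Compact y → carrier (x ⊗ y) → carrier x ∨ carrier y

/-- The Zariski topology on the Balmer spectrum, with basic open sets `{P | x ∈ P}` for `x` in
`T^c`. -/
instance : TopologicalSpace (Spc T) :=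
  TopologicalSpace.generateFrom {U | ∃ x : T, Compact x ∧ U = {P : Spc T | P.carrier x}}

/-- Thomason subsets of `Spc T^c`, that is, the open subsets for the Hochster dual topology: unions
of subsets with quasi-compact Zariski open complement. -/
def IsThomason (V : Set (Spc T)) : Prop :=
  ∃ F : Set (Set (Spc T)), (∀ W ∈ F, IsOpen Wᶜ ∧ _root_.IsCompact Wᶜ) ∧ V = ⋃₀ F

/-- `τ_⊗(V)`: the compact objects `x` with `{P | x ∉ P} ⊆ V`. -/
def tauCompact (V : Set (Spc T)) : ObjectProperty T :=
  fun x => Compact x ∧ ∀ P : Spc T, ¬ P.carrier x → P ∈ V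

/-- `T_V = loc (τ_⊗(V))`, for a Thomason subset `V`. -/
def locOpen (V : Set (Spc T)) : ObjectProperty T := loc (tauCompact V)

/-- The pair of Thomason subsets `U`, `V` exhibits `{p} = V ∖ U` as a locally closed subset for
the Hochster dual topology. -/
def ExhibitsPoint (p : Spc T) (U V : Set (Spc T)) : Prop :=
  IsThomason U ∧ IsThomason V ∧ V \ U = {p}

variable (T) in
/-- Each point of `Spc T^c` is locally closed for the Hochster dual topology. -/
def PointsLocallyClosed : Prop := ∀ p : Spc T, ∃ U V : Set (Spc T), ExhibitsPoint p U V

/-- `y` is (isomorphic to) the local cohomology object `Γ_p x = Γ_V (L_U x)`, where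
`{p} = V ∖ U` with `U`, `V` Thomason; up to isomorphism this is independent of `U` and `V`. -/
def IsLocalCohomology (p : Spc T) (x y : T) : Prop :=
  ∃ U V : Set (Spc T), ExhibitsPoint p U V ∧ ∃ a z b : T,
    IsLocalisationTriangle (locOpen U) a x z ∧ IsLocalisationTriangle (locOpen V) y z b

/-- `T_{p} = T_V ∩ (T_U)^⊥`, where `{p} = V ∖ U` with `U`, `V` Thomason. -/
def stratum (p : Spc T) : ObjectProperty T := fun x =>
  ∃ U V : Set (Spc T), ExhibitsPoint p U V ∧ locOpen V x ∧ (locOpen U).rightOrthogonal x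

/-- The tensor triangulated support `supp_⊗(x) = {p | Γ_p x ≠ 0}`. -/
def supp (x : T) : Set (Spc T) := {p | ∃ y : T, IsLocalCohomology p x y ∧ ¬ IsZero y}

/-- `supp_⊗(S) = ⋃_{x ∈ S} supp_⊗(x)`. -/
def suppIdeal (S : LocIdeal T) : Set (Spc T) := {p | ∃ x : T, S.1 x ∧ p ∈ supp x}

/-- `Γ_p S`: the objects isomorphic to `Γ_p x` for some `x` in `S`. -/
def gammaIdeal (p : Spc T) (S : ObjectProperty T) : ObjectProperty T :=
  fun y => ∃ x : T, S x ∧ IsLocalCohomology p x y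

variable (T) in
/-- The local-global principle for localising tensor ideals: every localising tensor ideal `S` is
the join of the `Γ_p S`. -/
def LocalGlobalPrinciple : Prop :=
  ∀ S : ObjectProperty T, IsLocalisingIdeal S → S = loc (⨆ p : Spc T, gammaIdeal p S)

variable (T) in
/-- For every `p`, there are no proper nonzero localising tensor ideals of `T_{p}`. -/
def Minimality : Prop :=
  ∀ (p : Spc T) (S : ObjectProperty T), IsLocalisingIdeal S → S ≤ stratum p →
    (∀ x, S x → IsZero x) ∨ S = stratum p

variable (T) in
/-- `T` is stratified via `Spc T^c`. -/
def IsStratified : Prop := LocalGlobalPrinciple T ∧ Minimality T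

end TensorTriangulated

end TTG

/-! Everything reduces to tensoring with idempotents. For each `V` the class `tauCompact V` is
essentially small, so cell attachment and a telescope produce localisation triangles for `locOpen
V`. Both `locOpen V` and its right orthogonal are tensor ideals (the second by rigidity), so the
triangle `e ⟶ 𝟙 ⟶ f` of the unit computes all others: `Γ_V x ≅ e ⊗ x` and `L_V x ≅ f ⊗ x`. Hence
`Γ_p` is tensoring with one object `Γ_p 𝟙`.

The objects `Γ_p 𝟙` are idempotent, independent of the chosen `U`, `V`, and pairwise orthogonal;
this rests on `isZero_tensor_of_subset_union`, which uses the existence of primes. They are nonzero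
by Neeman's theorem `prop_of_compact_of_loc`.

(1) ⇒ (3): the local-global principle generates `loc_⊗ x` by objects of strata at points `p ∈ supp x
⊆ supp y`. There `loc_⊗ y` contains `Γ_p y ≠ 0`, hence by minimality the whole stratum. For the
converse and (2), `Spc` is small, so coproducts let one object of an ideal carry all of its support
(`exists_subset_supp`); thus (3) compares ideals and not only objects. Surjectivity in (2) comes
from ideals generated by the `Γ_p 𝟙`, and (2) ⇒ (3) holds because `loc_⊗ x` has the same support as
`x`. -/

set_option linter.unusedSectionVars false

namespace TTG

/-! ### Compact objects, localising subcategories and Neeman's theorem. -/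

section Triangulated

variable {T : Type u} [Category.{v} T] [HasZeroObject T] [Preadditive T] [HasShift T ℤ]
  [∀ n : ℤ, (shiftFunctor T n).Additive] [Pretriangulated T] [HasCoproducts.{v} T]

open scoped ZeroObject

open scoped Classical in
/-- The idempotent endomorphism of a coproduct projecting to a finite subcoproduct. -/
noncomputable def truncation {ι : Type v} (y : ι → T) (J : Finset ι) : ∐ y ⟶ ∐ y :=
  ∑ j ∈ J, Sigma.π y j ≫ Sigma.ι y j

theorem ι_truncation {ι : Type v} (y : ι → T) (J : Finset ι) {i : ι} (hi : i ∈ J) :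
    Sigma.ι y i ≫ truncation y J = Sigma.ι y i := by
  classical
  rw [truncation, Preadditive.comp_sum, Finset.sum_eq_single_of_mem i hi]
  · rw [← Category.assoc, Sigma.ι_π_eq_id, Category.id_comp]
  · intro j _ hj
    rw [← Category.assoc, Sigma.ι_π_of_ne _ hj.symm, zero_comp]

theorem truncation_comp_truncation {ι : Type v} (y : ι → T) {J K : Finset ι} (h : J ⊆ K) :
    truncation y J ≫ truncation y K = truncation y J := by
  classical
  conv_lhs => rw [truncation]
  rw [Preadditive.sum_comp]
  refine Finset.sum_congr rfl fun j hj => ?_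
  rw [Category.assoc, ι_truncation y K (h hj)]

/-- Turns a factorisation through a finite subcoproduct into an equation on `φ`; such equations pass
easily to retracts and extensions. -/
theorem Compact.exists_truncation {x : T} (hx : Compact x) {ι : Type v} {y : ι → T}
    (φ : x ⟶ ∐ y) : ∃ J : Finset ι, φ ≫ truncation y J = φ := by
  obtain ⟨J, ψ, rfl⟩ := hx ι y φ
  refine ⟨J, ?_⟩
  rw [Category.assoc]
  congr 1
  refine Sigma.hom_ext _ _ fun j => ?_
  simp [ι_truncation y J j.2]

theorem compact_of_exists_sum {x : T}
    (h : ∀ (ι : Type v) (y : ι → T) (φ : x ⟶ ∐ y), ∃ (J : Finset ι) (ψ : ∀ i, x ⟶ y i),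
      φ = ∑ j ∈ J, ψ j ≫ Sigma.ι y j) : Compact x := by
  intro ι y φ
  obtain ⟨J, ψ, rfl⟩ := h ι y φ
  refine ⟨J, ∑ j ∈ J.attach, ψ j ≫ Sigma.ι (fun j : J => y j) j, ?_⟩
  rw [Preadditive.sum_comp]
  conv_rhs => rw [← Finset.sum_attach]
  simp

theorem compact_of_exists_truncation {x : T}
    (h : ∀ (ι : Type v) (y : ι → T) (φ : x ⟶ ∐ y), ∃ J : Finset ι, φ ≫ truncation y J = φ) :
    Compact x := by
  classical
  refine compact_of_exists_sum fun ι y φ => ?_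
  obtain ⟨J, hJ⟩ := h ι y φ
  refine ⟨J, fun i => φ ≫ Sigma.π y i, ?_⟩
  conv_lhs => rw [← hJ]
  simp [truncation, Preadditive.comp_sum]

theorem Compact.exists_sum {x : T} (hx : Compact x) {ι : Type v} {y : ι → T} (φ : x ⟶ ∐ y) :
    ∃ (J : Finset ι) (ψ : ∀ i, x ⟶ y i), φ = ∑ j ∈ J, ψ j ≫ Sigma.ι y j := by
  classical
  obtain ⟨J, hJ⟩ := hx.exists_truncation φ
  refine ⟨J, fun i => φ ≫ Sigma.π y i, ?_⟩
  conv_lhs => rw [← hJ]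
  simp [truncation, Preadditive.comp_sum]

/-- A left adjoint preserves compact objects if its right adjoint preserves coproducts. -/
theorem Compact.map_of_adjunction {F R : T ⥤ T} (adj : F ⊣ R) [F.Additive]
    [∀ ι : Type v, PreservesColimitsOfShape (Discrete ι) R] {x : T} (hx : Compact x) :
    Compact (F.obj x) := by
  refine compact_of_exists_sum fun ι y φ => ?_
  obtain ⟨J, ψ, hψ⟩ := hx.exists_sum (adj.homEquiv _ _ φ ≫ (PreservesCoproduct.iso R y).hom)
  refine ⟨J, fun i => (adj.homEquiv _ _).symm (ψ i), ?_⟩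
  have h2 : adj.homAddEquiv _ _ φ = ∑ j ∈ J, ψ j ≫ R.map (Sigma.ι y j) := by
    rw [← Iso.eq_comp_inv] at hψ
    rw [Adjunction.homAddEquiv_apply, hψ, Preadditive.sum_comp]
    refine Finset.sum_congr rfl fun j _ => ?_
    rw [Category.assoc, PreservesCoproduct.inv_hom, ι_comp_sigmaComparison]
  rw [← AddEquiv.eq_symm_apply, map_sum] at h2
  rw [h2]
  refine Finset.sum_congr rfl fun j _ => ?_
  rw [Adjunction.homAddEquiv_symm_apply, Adjunction.homEquiv_naturality_right_symm]

theorem Compact.of_retract {x y : T} (r : Retract x y) (hy : Compact y) : Compact x := by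
  refine compact_of_exists_truncation fun ι z φ => ?_
  obtain ⟨J, hJ⟩ := hy.exists_truncation (r.r ≫ φ)
  refine ⟨J, ?_⟩
  have := congrArg (r.i ≫ ·) hJ
  simpa using this

instance : (Compact : ObjectProperty T).IsStableUnderRetracts where
  of_retract r h := h.of_retract r

theorem compact_of_isZero {x : T} (hx : IsZero x) : Compact x :=
  compact_of_exists_truncation fun _ _ _ => ⟨∅, hx.eq_of_src _ _⟩

instance : (Compact : ObjectProperty T).IsTriangulated where
  exists_zero := ⟨0, isZero_zero T, compact_of_isZero (isZero_zero T)⟩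
  isStableUnderShiftBy n := ⟨fun x hx => by
    have : (shiftEquiv T n).functor.Additive := inferInstanceAs (shiftFunctor T n).Additive
    exact Compact.map_of_adjunction (shiftEquiv T n).toAdjunction hx⟩
  ext₂' := by
    classical
    rw [ObjectProperty.isoClosure_eq_self]
    intro t ht h₁ h₃
    refine compact_of_exists_truncation fun ι y φ => ?_
    obtain ⟨J, hJ⟩ := h₁.exists_truncation (t.mor₁ ≫ φ)
    -- The part of `φ` missed by `J` vanishes on `t.obj₁`, so it comes from `t.obj₃`, whose
    -- compactness supplies a second finite set.
    obtain ⟨ψ, hψ⟩ := Triangle.yoneda_exact₂ t ht (φ - φ ≫ truncation y J)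
      (by rw [Preadditive.comp_sub, ← Category.assoc, hJ, sub_self])
    obtain ⟨K, hK⟩ := h₃.exists_truncation ψ
    refine ⟨J ∪ K, ?_⟩
    have e : φ = φ ≫ truncation y J + t.mor₂ ≫ ψ ≫ truncation y K := by
      rw [hK, ← hψ]; abel
    rw [e, Preadditive.add_comp]
    simp only [Category.assoc, truncation_comp_truncation y Finset.subset_union_left,
      truncation_comp_truncation y Finset.subset_union_right]

theorem IsLocalising.inf {S S' : ObjectProperty T} (hS : IsLocalising S) (hS' : IsLocalising S') :
    IsLocalising (S ⊓ S') where
  triangulated := by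
    have := hS.triangulated
    have := hS'.triangulated
    have := hS'.iso
    infer_instance
  iso := by
    have := hS.iso
    have := hS'.iso
    exact ⟨fun e h => ⟨S.prop_of_iso e h.1, S'.prop_of_iso e h.2⟩⟩
  coprod ι y hy := ⟨hS.coprod ι y fun i => (hy i).1, hS'.coprod ι y fun i => (hy i).2⟩

theorem IsLocalising.sInf {A : Set (ObjectProperty T)} (hA : ∀ S ∈ A, IsLocalising S) :
    IsLocalising fun x => ∀ S ∈ A, S x := by
  have iso : ObjectProperty.IsClosedUnderIsomorphisms fun x : T => ∀ S ∈ A, S x :=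
    ⟨fun e h S hS => by have := (hA S hS).iso; exact S.prop_of_iso e (h S hS)⟩
  refine ⟨{ exists_zero := ⟨0, isZero_zero T, fun S hS => ?_⟩
            isStableUnderShiftBy := fun n => ⟨fun x hx S hS => ?_⟩
            ext₂' := ?_ }, iso, fun ι y hy S hS => (hA S hS).coprod ι y fun i => hy i S hS⟩
  · have := (hA S hS).triangulated
    have := (hA S hS).iso
    exact S.prop_zero
  · have := (hA S hS).triangulated
    exact S.le_shift n _ (hx S hS)
  · rw [ObjectProperty.isoClosure_eq_self]
    intro t ht h₁ h₃ S hS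
    have := (hA S hS).triangulated
    have := (hA S hS).iso
    exact S.ext_of_isTriangulatedClosed₂ t ht (h₁ S hS) (h₃ S hS)

theorem isLocalising_loc (X : ObjectProperty T) : IsLocalising (loc X) := by
  have := IsLocalising.sInf (A := {S : ObjectProperty T | IsLocalising S ∧ X ≤ S})
    fun S hS => hS.1
  convert this using 1
  ext x
  exact ⟨fun h S hS => h S hS.1 hS.2, fun h S hS hX => h S ⟨hS, hX⟩⟩

theorem le_loc (X : ObjectProperty T) : X ≤ loc X := fun _ hx _ _ hX => hX _ hx

theorem loc_le {X S : ObjectProperty T} (hS : IsLocalising S) (h : X ≤ S) : loc X ≤ S :=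
  fun _ hx => hx S hS h

theorem loc_mono {X Y : ObjectProperty T} (h : X ≤ Y) : loc X ≤ loc Y :=
  loc_le (isLocalising_loc Y) (h.trans (le_loc Y))

theorem isLocalising_leftOrthogonal (S : ObjectProperty T) [S.IsStableUnderShift ℤ] :
    IsLocalising S.leftOrthogonal :=
  ⟨inferInstance, inferInstance, fun _ _ hy _ _ hz =>
    Sigma.hom_ext _ _ fun i => (hy i _ hz).trans comp_zero.symm⟩

/-- The objects with no nonzero maps into a shift-stable class form a localising subcategory, so
testing against generators suffices. -/
theorem rightOrthogonal_loc (F : ObjectProperty T) [F.IsStableUnderShift ℤ] :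
    (loc F).rightOrthogonal = F.rightOrthogonal := by
  refine le_antisymm (fun y hy x f hx => hy f (le_loc F _ hx)) fun y hy x f hx => ?_
  have : loc F ≤ F.rightOrthogonal.leftOrthogonal :=
    loc_le (isLocalising_leftOrthogonal _) fun z hz w g hw => hw g hz
  exact this x hx f hy

theorem isLocalising_rightOrthogonal {F : ObjectProperty T} [F.IsStableUnderShift ℤ]
    (hF : F ≤ Compact) : IsLocalising F.rightOrthogonal := by
  refine ⟨inferInstance, inferInstance, fun ι y hy x f hx => ?_⟩
  obtain ⟨J, ψ, rfl⟩ := (hF x hx).exists_sum f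
  exact Finset.sum_eq_zero fun j _ => by rw [hy j (ψ j) hx, zero_comp]

theorem IsLocalising.inverseImage {S : ObjectProperty T} (hS : IsLocalising S) {F : T ⥤ T}
    (hF : IsExact F) [∀ ι : Type v, PreservesColimitsOfShape (Discrete ι) F] :
    IsLocalising (S.inverseImage F) := by
  obtain ⟨_, _⟩ := hF
  have := hS.triangulated
  have := hS.iso
  refine ⟨{ exists_zero := ⟨0, isZero_zero T, ?_⟩
            isStableUnderShiftBy := fun n => ⟨fun x hx => ?_⟩
            ext₂' := ?_ }, inferInstance, fun ι y hy => ?_⟩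
  · exact S.prop_of_isZero (F.map_isZero (isZero_zero T))
  · exact S.prop_of_iso ((F.commShiftIso n).app x).symm (S.le_shift n _ hx)
  · rw [ObjectProperty.isoClosure_eq_self]
    intro t ht h₁ h₃
    exact S.ext_of_isTriangulatedClosed₂ _ (F.map_distinguished t ht) h₁ h₃
  · exact S.prop_of_iso (PreservesCoproduct.iso F y).symm (hS.coprod ι _ hy)

/-- A morphism factors through an object of the class `F`. -/
def FactorsThrough (F : ObjectProperty T) {x y : T} (φ : x ⟶ y) : Prop :=
  ∃ b, F b ∧ ∃ (α : x ⟶ b) (β : b ⟶ y), α ≫ β = φ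

theorem prop_biprod (F : ObjectProperty T) [F.IsTriangulated] [F.IsClosedUnderIsomorphisms]
    {a b : T} (ha : F a) (hb : F b) : F (a ⊞ b) :=
  F.ext_of_isTriangulatedClosed₂ _ (binaryBiproductTriangle_distinguished a b) ha hb

theorem FactorsThrough.add {F : ObjectProperty T} [F.IsTriangulated]
    [F.IsClosedUnderIsomorphisms] {x y : T} {φ ψ : x ⟶ y} (hφ : FactorsThrough F φ)
    (hψ : FactorsThrough F ψ) : FactorsThrough F (φ + ψ) := by
  obtain ⟨b, hb, α, β, rfl⟩ := hφ
  obtain ⟨b', hb', α', β', rfl⟩ := hψ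
  exact ⟨b ⊞ b', prop_biprod F hb hb', biprod.lift α α', biprod.desc β β', by simp⟩

theorem FactorsThrough.zero {F : ObjectProperty T} [F.IsTriangulated]
    [F.IsClosedUnderIsomorphisms] {x y : T} : FactorsThrough F (0 : x ⟶ y) :=
  ⟨0, F.prop_zero, 0, 0, by simp⟩

theorem FactorsThrough.comp {F : ObjectProperty T} {x y z : T} {φ : x ⟶ y}
    (hφ : FactorsThrough F φ) (ψ : y ⟶ z) : FactorsThrough F (φ ≫ ψ) := by
  obtain ⟨b, hb, α, β, rfl⟩ := hφ
  exact ⟨b, hb, α, β ≫ ψ, by simp⟩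

/-- For a triangulated subcategory `F` of compact objects, the objects `a` such that every morphism
from a compact object to `a` factors through an object of `F` form a localising subcategory. -/
theorem isLocalising_factorsThrough {F : ObjectProperty T} [F.IsTriangulated]
    [F.IsClosedUnderIsomorphisms] (hF : F ≤ Compact) :
    IsLocalising fun a : T => ∀ (c : T) (φ : c ⟶ a), Compact c → FactorsThrough F φ := by
  have iso : ObjectProperty.IsClosedUnderIsomorphisms
      fun a : T => ∀ (c : T) (φ : c ⟶ a), Compact c → FactorsThrough F φ :=
    ⟨fun e h c φ hc => by simpa using (h c (φ ≫ e.inv) hc).comp e.hom⟩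
  refine ⟨{ exists_zero := ⟨0, isZero_zero T, fun c φ hc => ?_⟩
            isStableUnderShiftBy := fun n => ⟨fun a ha c φ hc => ?_⟩
            ext₂' := ?_ }, iso, fun ι y hy c φ hc => ?_⟩
  · rw [(isZero_zero T).eq_of_tgt φ 0]
    exact .zero
  · obtain ⟨ψ, rfl⟩ := ((shiftEquiv T n).symm.toAdjunction.homEquiv _ _).surjective φ
    obtain ⟨b, hb, α, β, rfl⟩ := ha _ ψ (Compact.le_shift (-n) _ hc)
    exact ⟨_, F.le_shift n _ hb, (shiftEquiv T n).symm.toAdjunction.homEquiv _ _ α, β⟦n⟧',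
      ((shiftEquiv T n).symm.toAdjunction.homEquiv_naturality_right α β).symm⟩
  · rw [ObjectProperty.isoClosure_eq_self]
    intro t ht h₁ h₃ c φ hc
    -- The fibre `d` of `α` is again compact, and on it `φ` lifts to `t.obj₁`, where the hypothesis
    -- yields `b` in `F`.
    obtain ⟨c₀, hc₀, α, β, hαβ⟩ := h₃ c (φ ≫ t.mor₂) hc
    obtain ⟨d, hd, u, w, hdist⟩ :=
      (Compact : ObjectProperty T).distinguished_cocone_triangle₁ α hc (hF _ hc₀)
    have huα : u ≫ α = 0 := comp_distTriang_mor_zero₁₂ _ hdist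
    have hwu : w ≫ u⟦(1 : ℤ)⟧' = 0 := comp_distTriang_mor_zero₃₁ _ hdist
    obtain ⟨l, hl⟩ := Triangle.coyoneda_exact₂ t ht (u ≫ φ) (by
      rw [Category.assoc, ← hαβ, ← Category.assoc, huα, zero_comp])
    obtain ⟨b, hb, γ, δ, hγδ⟩ := h₁ d l hd
    -- `e` is a homotopy pushout of `c` and `b` along `d`. As an extension of `c₀` by `b` it lies in
    -- `F`.
    obtain ⟨e, he, i, p, hdist'⟩ :=
      F.distinguished_cocone_triangle₂ (w ≫ γ⟦(1 : ℤ)⟧') hb hc₀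
    obtain ⟨(θ : c ⟶ e), hθ, -⟩ := complete_distinguished_triangle_morphism₂ _ _ hdist
      hdist' γ (𝟙 c₀) (Category.id_comp _).symm
    obtain ⟨(ψ : e ⟶ t.obj₂), hψ, -⟩ := complete_distinguished_triangle_morphism₂ _ _ hdist'
      (contractible_distinguished t.obj₂) (δ ≫ t.mor₁) 0 (by
        change (w ≫ γ⟦(1 : ℤ)⟧') ≫ (δ ≫ t.mor₁)⟦(1 : ℤ)⟧' = 0 ≫ 0
        rw [zero_comp, Category.assoc, ← Functor.map_comp, ← Category.assoc γ, hγδ, ← hl,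
          Functor.map_comp, ← Category.assoc, hwu, zero_comp])
    change u ≫ θ = γ ≫ i at hθ
    change i ≫ ψ = (δ ≫ t.mor₁) ≫ 𝟙 _ at hψ
    rw [Category.comp_id] at hψ
    -- `φ` and `θ ≫ ψ` agree on `d`, so their difference factors through `c₀`, which is also in `F`.
    obtain ⟨(ρ : c₀ ⟶ t.obj₂), hρ⟩ := Triangle.yoneda_exact₂ _ hdist (φ - θ ≫ ψ) (by
      change u ≫ (φ - θ ≫ ψ) = 0
      rw [Preadditive.comp_sub, ← Category.assoc u θ, hθ, Category.assoc, hψ, ← Category.assoc γ,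
        hγδ, ← hl, sub_self])
    change φ - θ ≫ ψ = α ≫ ρ at hρ
    have : φ = θ ≫ ψ + α ≫ ρ := by rw [← hρ]; abel
    rw [this]
    exact .add ⟨e, he, θ, ψ, rfl⟩ ⟨c₀, hc₀, α, ρ, rfl⟩
  · obtain ⟨J, ψ, rfl⟩ := hc.exists_sum φ
    exact Finset.sum_induction _ (FactorsThrough F) (fun _ _ => .add) .zero
      fun j _ => (hy j c (ψ j) hc).comp _

/-- Neeman's theorem on compact objects in localising subcategories generated by compact
objects. -/
theorem prop_of_compact_of_loc {F : ObjectProperty T} [F.IsTriangulated]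
    [F.IsStableUnderRetracts] (hF : F ≤ Compact) {x : T} (hx : Compact x) (h : loc F x) :
    F x := by
  -- Factoring the identity of `x` exhibits `x` as a retract of an object of `F`.
  obtain ⟨b, hb, α, β, e⟩ := loc_le (isLocalising_factorsThrough hF)
    (fun a ha c φ _ => ⟨a, ha, φ, 𝟙 a, by simp⟩) x h x (𝟙 x) hx
  exact F.prop_of_retract ⟨α, β, e⟩ hb

end Triangulated

/-! ### Essential smallness of triangulated envelopes. -/

section Smallness

variable {C : Type u} [Category.{v} C]

/-- A retract is determined up to isomorphism by its idempotent `r.r ≫ r.i`, and the endomorphisms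
of a small family of objects form a small set. -/
theorem essentiallySmall_retractClosure (P : ObjectProperty C)
    [ObjectProperty.EssentiallySmall.{v} P] :
    ObjectProperty.EssentiallySmall.{v} P.retractClosure := by
  obtain ⟨Q, _, _, hQ⟩ := ObjectProperty.EssentiallySmall.exists_small_le.{v} P
  let R (p : Σ q : Subtype Q, (q.1 ⟶ q.1)) : ObjectProperty C := fun x =>
    ∃ r : Retract x p.1.1, r.r ≫ r.i = p.2
  have hR (p) : ObjectProperty.EssentiallySmall.{v} (R p) := by
    by_cases h : ∃ x, R p x
    · obtain ⟨x, r, hr⟩ := h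
      refine ⟨.singleton x, inferInstance, ?_⟩
      rintro y ⟨s, hs⟩
      refine ⟨x, by simp, ⟨⟨s.i ≫ r.r, r.i ≫ s.r, ?_, ?_⟩⟩⟩
      · have : s.i ≫ (r.r ≫ r.i) ≫ s.r = 𝟙 y := by
          rw [hr, ← hs]; simp
        simpa using this
      · have : r.i ≫ (s.r ≫ s.i) ≫ r.r = 𝟙 x := by
          rw [hs, ← hr]; simp
        simpa using this
    · have : IsEmpty (Subtype (R p)) := ⟨fun x => h ⟨x.1, x.2⟩⟩
      exact ⟨R p, small_of_injective (Function.injective_of_subsingleton (id : Subtype (R p) → _)),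
        ObjectProperty.le_isoClosure _⟩
  refine ObjectProperty.EssentiallySmall.of_le (Q := ⨆ p, R p) ?_
  rintro x ⟨y, hy, ⟨r⟩⟩
  obtain ⟨z, hz, ⟨e⟩⟩ := hQ y hy
  rw [ObjectProperty.prop_iSup_iff]
  exact ⟨⟨⟨z, hz⟩, e.inv ≫ r.r ≫ r.i ≫ e.hom⟩, ⟨⟨r.i ≫ e.hom, e.inv ≫ r.r, by simp⟩, by simp⟩⟩

theorem essentiallySmall_shiftClosure [HasShift C ℤ] (P : ObjectProperty C)
    [ObjectProperty.EssentiallySmall.{v} P] :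
    ObjectProperty.EssentiallySmall.{v} (P.shiftClosure ℤ) := by
  refine ObjectProperty.EssentiallySmall.of_le
    (Q := ⨆ n : ℤ, P.map (shiftFunctor C n)) ?_
  rintro x hx
  rw [ObjectProperty.prop_iSup_iff]
  obtain ⟨y, n, e, hy⟩ := hx
  exact ⟨n, y, hy, ⟨e.symm⟩⟩

variable [HasZeroObject C] [Preadditive C] [HasShift C ℤ]
  [∀ n : ℤ, (shiftFunctor C n).Additive] [Pretriangulated C]

/-- An extension is determined up to isomorphism by its connecting morphism. -/
theorem essentiallySmall_extensionProduct (P Q : ObjectProperty C)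
    [ObjectProperty.EssentiallySmall.{v} P] [ObjectProperty.EssentiallySmall.{v} Q] :
    ObjectProperty.EssentiallySmall.{v} (ObjectProperty.extensionProduct P Q) := by
  obtain ⟨P', _, _, hP⟩ := ObjectProperty.EssentiallySmall.exists_small_le.{v} P
  obtain ⟨Q', _, _, hQ⟩ := ObjectProperty.EssentiallySmall.exists_small_le.{v} Q
  let ι := Σ (a : Subtype P') (b : Subtype Q'), (b.1 ⟶ a.1⟦(1 : ℤ)⟧)
  choose c f g hc using fun p : ι => distinguished_cocone_triangle₂ p.2.2
  refine ⟨.ofObj c, inferInstance, ?_⟩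
  intro x hx
  replace hx := ObjectProperty.monotone_extensionProduct_right _ hQ _
    (ObjectProperty.monotone_extensionProduct_left _ hP _ hx)
  rw [ObjectProperty.extensionProduct_isoClosure_left,
    ObjectProperty.extensionProduct_isoClosure_right] at hx
  obtain ⟨a, b, i, p, w, hT, ha, hb⟩ := hx
  exact ⟨_, ObjectProperty.ofObj_apply c ⟨⟨a, ha⟩, ⟨b, hb⟩, w⟩,
    ⟨Triangle.π₂.mapIso (isoTriangleOfIso₁₃ _ _ hT (hc ⟨⟨a, ha⟩, ⟨b, hb⟩, w⟩)
      (Iso.refl _) (Iso.refl _) (by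
        change w ≫ (𝟙 a)⟦(1 : ℤ)⟧' = 𝟙 b ≫ w
        rw [CategoryTheory.Functor.map_id, Category.comp_id, Category.id_comp]))⟩⟩

theorem essentiallySmall_triangEnvelope (P : ObjectProperty C)
    [ObjectProperty.EssentiallySmall.{v} P] :
    ObjectProperty.EssentiallySmall.{v} P.triangEnvelope := by
  have := essentiallySmall_shiftClosure P
  have : ObjectProperty.EssentiallySmall.{v} (P.shiftClosure ℤ).binaryProductsClosure := by
    unfold ObjectProperty.binaryProductsClosure
    infer_instance
  have := essentiallySmall_retractClosure (P.shiftClosure ℤ).binaryProductsClosure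
  have (n : ℕ) : ObjectProperty.EssentiallySmall.{v} (P.triangEnvelopeIter n) := by
    induction n with
    | zero =>
      rw [ObjectProperty.triangEnvelopeIter_zero]
      infer_instance
    | succ n ih =>
      rw [ObjectProperty.triangEnvelopeIter_succ]
      have := essentiallySmall_extensionProduct
        (P.shiftClosure ℤ).binaryProductsClosure.retractClosure (P.triangEnvelopeIter n)
      exact essentiallySmall_retractClosure _
  unfold ObjectProperty.triangEnvelope
  infer_instance

end Smallness

/-! ### Localisation triangles by cell attachment and telescopes. -/

section Triangulated

open scoped ZeroObject

variable {T : Type u} [Category.{v} T] [HasZeroObject T] [Preadditive T] [HasShift T ℤ]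
  [∀ n : ℤ, (shiftFunctor T n).Additive] [Pretriangulated T] [HasCoproducts.{v} T]

/-- In a compactly generated triangulated category the compact objects are essentially small. -/
theorem essentiallySmall_compact [IsTriangulated T] (hT : IsCompactlyGenerated T) :
    ObjectProperty.EssentiallySmall.{v} (Compact : ObjectProperty T) := by
  obtain ⟨ι, G, hG, hgen⟩ := hT
  let P : ObjectProperty T := .ofObj G ⊔ .singleton (0 : T)
  have hP : P ≤ Compact := by
    refine sup_le ?_ ?_
    · rintro _ ⟨i⟩
      exact hG i
    · rintro _ ⟨⟩
      exact compact_of_isZero (isZero_zero T)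
  have : P.Nonempty := ⟨0, Or.inr (by simp)⟩
  have := essentiallySmall_triangEnvelope P
  have hle : P.triangEnvelope ≤ Compact := P.triangEnvelope_le_iff.2 hP
  refine ObjectProperty.EssentiallySmall.of_le (Q := P.triangEnvelope) fun x hx => ?_
  exact prop_of_compact_of_loc hle hx (hgen _ (isLocalising_loc _)
    (fun i => le_loc _ _ (P.le_triangEnvelope _ (Or.inl ⟨i⟩))) x)

/-- The cell-attachment step of the construction of colocalisations: every morphism from one of the
objects `G i` that vanishes in `x` is killed. -/
theorem exists_attach {ι : Type v} (G : ι → T) {x a : T} (f : a ⟶ x) :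
    ∃ (a' : T) (i : a ⟶ a') (f' : a' ⟶ x), i ≫ f' = f ∧
      (∀ S : ObjectProperty T, IsLocalising S → (∀ j, S (G j)) → S a → S a') ∧
      ∀ (j : ι) (k : G j ⟶ a), k ≫ f = 0 → k ≫ i = 0 := by
  let I := Σ j : ι, {k : G j ⟶ a // k ≫ f = 0}
  let κ : (∐ fun p : I => G p.1) ⟶ a := Sigma.desc fun p => p.2.1
  obtain ⟨a', i, w, hd⟩ := distinguished_cocone_triangle κ
  obtain ⟨f', hf'⟩ := Triangle.yoneda_exact₂ _ hd f
    (show κ ≫ f = 0 from Sigma.hom_ext _ _ fun p => by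
      rw [comp_zero, ← p.2.2]; exact (Sigma.ι_desc_assoc _ _ _))
  refine ⟨a', i, f', hf'.symm, fun S hS hG ha => ?_, fun j k hk => ?_⟩
  · have := hS.triangulated
    have := hS.iso
    exact S.ext_of_isTriangulatedClosed₃ _ hd (hS.coprod _ _ fun p => hG p.1) ha
  · have h : κ ≫ i = 0 := comp_distTriang_mor_zero₁₂ _ hd
    have e : Sigma.ι (fun p : I => G p.1) ⟨j, k, hk⟩ ≫ κ = k := Sigma.ι_desc _ _
    rw [← e, Category.assoc, h, comp_zero]

/-- Iterated cell attachment. -/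
theorem exists_attach_sequence {ι : Type v} (G : ι → T) (x : T) :
    ∃ (A : ℕ → T) (i : ∀ n, A n ⟶ A (n + 1)) (f : ∀ n, A n ⟶ x),
      (∀ n, i n ≫ f (n + 1) = f n) ∧
      (∀ S : ObjectProperty T, IsLocalising S → (∀ j, S (G j)) → ∀ n, S (A n)) ∧
      (∀ (n : ℕ) (j : ι) (k : G j ⟶ A n), k ≫ f n = 0 → k ≫ i n = 0) ∧
      ∀ (j : ι) (k : G j ⟶ x), ∃ l : G j ⟶ A 0, l ≫ f 0 = k := by
  choose a' i f' h₁ h₂ h₃ using fun p : Σ a : T, (a ⟶ x) => exists_attach G p.2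
  let I := Σ j : ι, (G j ⟶ x)
  let A : ℕ → Σ a : T, (a ⟶ x) := fun n =>
    Nat.rec ⟨∐ fun p : I => G p.1, Sigma.desc fun p => p.2⟩ (fun _ p => ⟨a' p, f' p⟩) n
  refine ⟨fun n => (A n).1, fun n => i (A n), fun n => (A n).2, fun n => h₁ (A n), ?_,
    fun n => h₃ (A n), fun j k => ⟨Sigma.ι (fun p : I => G p.1) ⟨j, k⟩, Sigma.ι_desc _ _⟩⟩
  intro S hS hG n
  induction n with
  | zero => exact hS.coprod _ _ fun p => hG p.1
  | succ n ih => exact h₂ (A n) S hS hG ih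

/-- For `w` the connecting morphism of a cone of `f`, this lifts `h` along the map into the cone.
Injectivity of `f` on maps from `s⟦-1⟧` is carried over by the shift adjunction. -/
theorem comp_eq_zero_of_shift {a b c s : T} (f : a ⟶ b) (w : c ⟶ a⟦(1 : ℤ)⟧)
    (hw : w ≫ f⟦(1 : ℤ)⟧' = 0) (h : s ⟶ c)
    (hinj : ∀ χ : s⟦(-1 : ℤ)⟧ ⟶ a, χ ≫ f = 0 → χ = 0) : h ≫ w = 0 := by
  let adj : shiftFunctor T (-1 : ℤ) ⊣ shiftFunctor T (1 : ℤ) :=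
    (shiftEquiv T (1 : ℤ)).symm.toAdjunction
  obtain ⟨χ, hχ⟩ := (adj.homAddEquiv _ _).surjective (h ≫ w)
  rw [← hχ, hinj χ, map_zero]
  apply (adj.homAddEquiv _ _).injective
  rw [map_zero, Adjunction.homAddEquiv_apply, Adjunction.homEquiv_naturality_right,
    ← Adjunction.homAddEquiv_apply, hχ, Category.assoc, hw, comp_zero]

section Telescope

variable (A : ℕ → T) (i : ∀ n, A n ⟶ A (n + 1))

/-- The shift endomorphism of the coproduct of a sequence. -/
noncomputable def telescopeShift :
    (∐ fun n : ULift.{v} ℕ => A n.down) ⟶ ∐ fun n : ULift.{v} ℕ => A n.down :=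
  Sigma.desc fun n => i n.down ≫ Sigma.ι (fun n : ULift.{v} ℕ => A n.down) ⟨n.down + 1⟩

/-- A map fixed by the shift has zero component at `0`, hence at each later index by induction.
Compactness is needed to conclude `χ = 0` from its components. -/
theorem eq_zero_of_comp_telescopeShift {c : T} (hc : Compact c)
    (χ : c ⟶ ∐ fun n : ULift.{v} ℕ => A n.down)
    (h : χ ≫ (𝟙 _ - telescopeShift A i) = 0) : χ = 0 := by
  classical
  have e : χ = χ ≫ telescopeShift A i := by
    rwa [Preadditive.comp_sub, Category.comp_id, sub_eq_zero] at h
  have hπ (n : ℕ) : χ ≫ Sigma.π (fun n : ULift.{v} ℕ => A n.down) ⟨n⟩ = 0 := by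
    induction n with
    | zero =>
      rw [e, Category.assoc]
      convert comp_zero using 2
      refine Sigma.hom_ext _ _ fun m => ?_
      rw [telescopeShift, Sigma.ι_desc_assoc, Category.assoc, Sigma.ι_π_of_ne, comp_zero,
        comp_zero]
      simp
    | succ n ih =>
      have : telescopeShift A i ≫ Sigma.π (fun n : ULift.{v} ℕ => A n.down) ⟨n + 1⟩ =
          Sigma.π (fun n : ULift.{v} ℕ => A n.down) ⟨n⟩ ≫ i n := by
        refine Sigma.hom_ext _ _ fun m => ?_
        rw [telescopeShift, Sigma.ι_desc_assoc, Category.assoc]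
        by_cases hm : m = ⟨n⟩
        · subst hm
          rw [Sigma.ι_π_eq_id, Category.comp_id, ← Category.assoc, Sigma.ι_π_eq_id,
            Category.id_comp]
        · rw [Sigma.ι_π_of_ne, ← Category.assoc, Sigma.ι_π_of_ne _ hm, comp_zero, zero_comp]
          intro h'
          apply hm
          ext
          simpa using congrArg ULift.down h'
      rw [e, Category.assoc, this, ← Category.assoc, ih, zero_comp]
  obtain ⟨J, hJ⟩ := hc.exists_truncation χ
  rw [← hJ, truncation, Preadditive.comp_sum]
  refine Finset.sum_eq_zero fun j _ => ?_
  rw [← Category.assoc]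
  convert zero_comp using 2
  convert hπ j.down

/-- The homotopy colimit (telescope) of a sequence, with the factorisation property of compact
objects. -/
theorem exists_telescope {x : T} (f : ∀ n, A n ⟶ x) (hf : ∀ n, i n ≫ f (n + 1) = f n) :
    ∃ (a : T) (q : ∀ n, A n ⟶ a) (g : a ⟶ x),
      (∀ n, i n ≫ q (n + 1) = q n) ∧ (∀ n, q n ≫ g = f n) ∧
      (∀ S : ObjectProperty T, IsLocalising S → (∀ n, S (A n)) → S a) ∧
      ∀ (c : T) (h : c ⟶ a), Compact c → ∃ (n : ℕ) (h' : c ⟶ A n), h' ≫ q n = h := by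
  let B : ULift.{v} ℕ → T := fun n => A n.down
  let t : ∐ B ⟶ ∐ B := 𝟙 _ - telescopeShift A i
  have ht (n : ℕ) : Sigma.ι B ⟨n⟩ ≫ t = Sigma.ι B ⟨n⟩ - i n ≫ Sigma.ι B ⟨n + 1⟩ := by
    simp only [t]
    rw [Preadditive.comp_sub, Category.comp_id, telescopeShift]
    congr 1
    exact Sigma.ι_desc _ _
  obtain ⟨a, q, w, hd⟩ := distinguished_cocone_triangle t
  have htq : t ≫ q = 0 := comp_distTriang_mor_zero₁₂ _ hd
  have hwt : w ≫ t⟦(1 : ℤ)⟧' = 0 := comp_distTriang_mor_zero₃₁ _ hd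
  obtain ⟨(g : a ⟶ x), (hg : _ = q ≫ g)⟩ := Triangle.yoneda_exact₂ _ hd
    (Sigma.desc fun n => f n.down : ∐ B ⟶ x) (by
      change t ≫ _ = (0 : ∐ B ⟶ x)
      refine Sigma.hom_ext _ _ fun n => ?_
      change Sigma.ι B ⟨n.down⟩ ≫ t ≫ _ = _
      rw [← Category.assoc, ht, Preadditive.sub_comp, Category.assoc]
      erw [Sigma.ι_desc, Sigma.ι_desc]
      rw [hf, sub_self, comp_zero])
  have hiq (n : ℕ) : i n ≫ Sigma.ι B ⟨n + 1⟩ ≫ q = Sigma.ι B ⟨n⟩ ≫ q := by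
    have := ht n =≫ q
    rw [Category.assoc, htq, comp_zero, Preadditive.sub_comp, Category.assoc] at this
    exact (sub_eq_zero.1 this.symm).symm
  refine ⟨a, fun n => Sigma.ι B ⟨n⟩ ≫ q, g, hiq, fun n => ?_, fun S hS hA => ?_,
    fun c h hc => ?_⟩
  · rw [Category.assoc, ← hg]
    exact Sigma.ι_desc _ _
  · have := hS.triangulated
    have := hS.iso
    have hB : S (∐ B) := hS.coprod _ _ fun n => hA n.down
    exact S.ext_of_isTriangulatedClosed₃ _ hd hB hB
  · have hw : h ≫ w = 0 := comp_eq_zero_of_shift t w hwt h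
      (eq_zero_of_comp_telescopeShift A i (Compact.le_shift (-1 : ℤ) _ hc))
    obtain ⟨(l : c ⟶ ∐ B), (hl : h = l ≫ q)⟩ := Triangle.coyoneda_exact₃ _ hd h hw
    obtain ⟨J, ψ, rfl⟩ := hc.exists_sum l
    -- The finitely many components of the lift can be pushed forward to a common stage.
    have hle {n m : ℕ} (hnm : n ≤ m) (k : c ⟶ A n) :
        ∃ k' : c ⟶ A m, k' ≫ Sigma.ι B ⟨m⟩ ≫ q = k ≫ Sigma.ι B ⟨n⟩ ≫ q := by
      induction hnm with
      | refl => exact ⟨k, rfl⟩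
      | step _ ih =>
        obtain ⟨k', hk'⟩ := ih
        exact ⟨k' ≫ i _, by rw [← hk', Category.assoc, hiq]⟩
    rw [hl, Preadditive.sum_comp]
    refine Finset.sum_induction _
      (fun φ => ∃ (n : ℕ) (h' : c ⟶ A n), h' ≫ Sigma.ι B ⟨n⟩ ≫ q = φ) ?_ ⟨0, 0, zero_comp⟩ ?_
    · rintro _ _ ⟨n, k, rfl⟩ ⟨m, l, rfl⟩
      obtain ⟨k', hk'⟩ := hle (le_max_left n m) k
      obtain ⟨l', hl'⟩ := hle (le_max_right n m) l
      exact ⟨max n m, k' + l', by rw [Preadditive.add_comp, hk', hl']⟩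
    · intro j _
      exact ⟨j.down, ψ j, by rw [Category.assoc]⟩

end Telescope

/-- Localisation triangles exist for localising subcategories generated by an essentially small
shift-stable class of compact objects. -/
theorem exists_isLocalisationTriangle {F : ObjectProperty T} [F.IsStableUnderShift ℤ]
    [ObjectProperty.EssentiallySmall.{v} F] (hF : F ≤ Compact) (x : T) :
    ∃ a b, IsLocalisationTriangle (loc F) a x b := by
  obtain ⟨Q, _, hQF, hFQ⟩ := ObjectProperty.EssentiallySmall.exists_small_le.{v} F
  let G : Shrink.{v} (Subtype Q) → T := fun j => ((equivShrink _).symm j).1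
  have hG (j) : F (G j) := hQF _ ((equivShrink _).symm j).2
  have hGF (s : T) (hs : F s) : ∃ j, Nonempty (s ≅ G j) := by
    obtain ⟨y, hy, ⟨e⟩⟩ := hFQ s hs
    refine ⟨equivShrink _ ⟨y, hy⟩, ⟨e ≪≫ eqToIso ?_⟩⟩
    simp [G]
  obtain ⟨A, i, f, hf, hA, hker, hsurj⟩ := exists_attach_sequence G x
  obtain ⟨a, q, g, hq, hqg, ha, hc⟩ := exists_telescope A i f hf
  -- A map to the telescope lives at some stage `n`; if it dies in `x`, the next attachment kills
  -- it.
  have hinj (s : T) (hs : F s) (k : s ⟶ a) (hk : k ≫ g = 0) : k = 0 := by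
    obtain ⟨j, ⟨e⟩⟩ := hGF s hs
    obtain ⟨n, h', hh⟩ := hc (G j) (e.inv ≫ k) (hF _ (hG j))
    have : h' ≫ f n = 0 := by
      rw [← hqg, ← Category.assoc, hh, Category.assoc, hk, comp_zero]
    have h0 : e.inv ≫ k = 0 := by
      rw [← hh, ← hq, ← Category.assoc, hker n j h' this, zero_comp]
    rw [← cancel_epi e.inv, h0, comp_zero]
  have hlift (s : T) (hs : F s) (k : s ⟶ x) : ∃ l : s ⟶ a, l ≫ g = k := by
    obtain ⟨j, ⟨e⟩⟩ := hGF s hs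
    obtain ⟨l, hl⟩ := hsurj j (e.inv ≫ k)
    exact ⟨e.hom ≫ l ≫ q 0, by simp [hqg, hl]⟩
  obtain ⟨b, p, w, hd⟩ := distinguished_cocone_triangle g
  have hgp : g ≫ p = 0 := comp_distTriang_mor_zero₁₂ _ hd
  have hwg : w ≫ g⟦(1 : ℤ)⟧' = 0 := comp_distTriang_mor_zero₃₁ _ hd
  refine ⟨a, b, ha _ (isLocalising_loc F) (hA _ (isLocalising_loc F) fun j => le_loc F _ (hG j)),
    ?_, g, p, w, hd⟩
  rw [rightOrthogonal_loc]
  intro s h hs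
  have hw : h ≫ w = 0 := comp_eq_zero_of_shift g w hwg h (hinj _ (F.le_shift (-1 : ℤ) _ hs))
  obtain ⟨(l : s ⟶ x), (hl : h = l ≫ p)⟩ := Triangle.coyoneda_exact₃ _ hd h hw
  obtain ⟨l', rfl⟩ := hlift s hs l
  rw [hl, Category.assoc, hgp, comp_zero]

end Triangulated

/-! ### Duality for rigid objects. -/

section Rigid

variable {C : Type u} [Category.{v} C] [MonoidalCategory C] [MonoidalClosed C]

theorem uncurry_dualTensorMap (x y : C) : MonoidalClosed.uncurry (dualTensorMap x y) =
    (α_ x ((ihom x).obj (𝟙_ C)) y).inv ≫ ((ihom.ev x).app (𝟙_ C)) ▷ y ≫ (λ_ y).hom :=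
  MonoidalClosed.uncurry_curry _

/-- The coevaluation of a dualisable object. -/
noncomputable def dualCoev {x : C} (hx : Dualisable x) :
    𝟙_ C ⟶ (ihom x).obj (𝟙_ C) ⊗ x :=
  have := hx x
  MonoidalClosed.curry (ρ_ x).hom ≫ inv (dualTensorMap x x)

theorem whiskerLeft_dualCoev {x : C} (hx : Dualisable x) :
    x ◁ dualCoev hx ≫ (α_ x ((ihom x).obj (𝟙_ C)) x).inv ≫
      ((ihom.ev x).app (𝟙_ C)) ▷ x = (ρ_ x).hom ≫ (λ_ x).inv := by
  have := hx x
  have h : dualCoev hx ≫ dualTensorMap x x = MonoidalClosed.curry (ρ_ x).hom := by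
    simp [dualCoev]
  have h' := congrArg MonoidalClosed.uncurry h
  rw [MonoidalClosed.uncurry_natural_left, uncurry_dualTensorMap,
    MonoidalClosed.uncurry_curry] at h'
  rw [Iso.eq_comp_inv]
  simpa using h'

/-- One triangle identity implies the other after evaluation: two copies of `ε` are interchanged.
When `d` is the internal dual, injectivity of uncurrying then removes the evaluation. -/
theorem whiskerLeft_comp_eval {x d : C} (η : 𝟙_ C ⟶ d ⊗ x) (ε : x ⊗ d ⟶ 𝟙_ C)
    (h : x ◁ η ≫ (α_ x d x).inv ≫ ε ▷ x = (ρ_ x).hom ≫ (λ_ x).inv) :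
    x ◁ ((η ▷ d ≫ (α_ _ _ _).hom ≫ d ◁ ε) ≫ (ρ_ d).hom) ≫ ε = x ◁ (λ_ d).hom ≫ ε := by
  calc _ = x ◁ η ▷ d ≫ x ◁ (α_ d x d).hom ≫ (α_ x d (x ⊗ d)).inv ≫
        ((x ⊗ d) ◁ ε ≫ ε ▷ 𝟙_ C) ≫ (ρ_ (𝟙_ C)).hom := by
          simp [MonoidalCategory.whiskerLeft_comp]
    _ = x ◁ η ▷ d ≫ x ◁ (α_ d x d).hom ≫ (α_ x d (x ⊗ d)).inv ≫
        (ε ▷ (x ⊗ d) ≫ 𝟙_ C ◁ ε) ≫ (ρ_ (𝟙_ C)).hom := by rw [whisker_exchange]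
    _ = (α_ x (𝟙_ C) d).inv ≫ (x ◁ η ≫ (α_ x d x).inv ≫ ε ▷ x) ▷ d ≫
        (α_ (𝟙_ C) x d).hom ≫ (λ_ (x ⊗ d)).hom ≫ ε := by
          simp only [← unitors_equal]
          simp
    _ = _ := by
          rw [h]
          simp

theorem dualCoev_whiskerRight {x : C} (hx : Dualisable x) :
    dualCoev hx ▷ (ihom x).obj (𝟙_ C) ≫ (α_ _ _ _).hom ≫
      (ihom x).obj (𝟙_ C) ◁ (ihom.ev x).app (𝟙_ C) =
        (λ_ ((ihom x).obj (𝟙_ C))).hom ≫ (ρ_ _).inv := by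
  rw [Iso.eq_comp_inv]
  apply MonoidalClosed.uncurry_injective
  rw [MonoidalClosed.uncurry_eq, MonoidalClosed.uncurry_eq]
  exact whiskerLeft_comp_eval _ _ (whiskerLeft_dualCoev hx)

/-- A dualisable object and its dual form an exact pairing. -/
noncomputable abbrev dualExactPairing {x : C} (hx : Dualisable x) :
    ExactPairing ((ihom x).obj (𝟙_ C)) x where
  coevaluation' := dualCoev hx
  evaluation' := (ihom.ev x).app (𝟙_ C)
  coevaluation_evaluation' := whiskerLeft_dualCoev hx
  evaluation_coevaluation' := dualCoev_whiskerRight hx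

/-- A dualisable object `x` is a retract of `(x ⊗ xᵛ) ⊗ x`. -/
noncomputable def dualRetract {x : C} (hx : Dualisable x) :
    Retract x ((x ⊗ (ihom x).obj (𝟙_ C)) ⊗ x) where
  i := (ρ_ x).inv ≫ x ◁ dualCoev hx ≫ (α_ _ _ _).inv
  r := (ihom.ev x).app (𝟙_ C) ▷ x ≫ (λ_ x).hom
  retract := by
    have := whiskerLeft_dualCoev hx
    simp only [Category.assoc]
    rw [Iso.inv_comp_eq, Category.comp_id]
    rw [Iso.eq_comp_inv] at this
    simpa using this

end Rigid

/-! ### Localising ideals and idempotent triangles. -/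

section TensorTriangulated

variable {T : Type u} [Category.{v} T] [HasZeroObject T] [Preadditive T] [HasShift T ℤ]
  [∀ n : ℤ, (shiftFunctor T n).Additive] [Pretriangulated T] [HasCoproducts.{v} T]
  [MonoidalCategory T] [SymmetricCategory T] [MonoidalClosed T]

instance preservesColimitsOfShape_tensorRight (x : T) (ι : Type v) :
    PreservesColimitsOfShape (Discrete ι) (tensorRight x) :=
  preservesColimitsOfShape_of_natIso (BraidedCategory.tensorLeftIsoTensorRight x)

namespace IsRigidlyCompactlyGenerated

variable (hT : IsRigidlyCompactlyGenerated T)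
include hT

theorem isZero_tensor_left {x : T} (hx : IsZero x) (y : T) : IsZero (x ⊗ y) := by
  obtain ⟨_, _⟩ := hT.tensorRight_exact y
  exact (tensorRight y).map_isZero hx

theorem isZero_tensor_right (x : T) {y : T} (hy : IsZero y) : IsZero (x ⊗ y) := by
  obtain ⟨_, _⟩ := hT.tensorLeft_exact x
  exact (tensorLeft x).map_isZero hy

theorem isLocalising_tensorRight {S : ObjectProperty T} (hS : IsLocalising S) (y : T) :
    IsLocalising fun t : T => S (t ⊗ y) :=
  hS.inverseImage (hT.tensorRight_exact y)

theorem isLocalising_tensorLeft {S : ObjectProperty T} (hS : IsLocalising S) (x : T) :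
    IsLocalising fun t : T => S (x ⊗ t) :=
  hS.inverseImage (hT.tensorLeft_exact x)

theorem prop_of_compact_le {S : ObjectProperty T} (hS : IsLocalising S) (h : Compact ≤ S)
    (x : T) : S x := by
  obtain ⟨ι, G, hG, hgen⟩ := hT.compactlyGenerated
  exact hgen S hS (fun i => h _ (hG i)) x

theorem isLocalisingIdeal_of_compact {S : ObjectProperty T} (hS : IsLocalising S)
    (h : ∀ x y : T, Compact x → S y → S (x ⊗ y)) : IsLocalisingIdeal S :=
  ⟨hS, fun x y hy => hT.prop_of_compact_le (hT.isLocalising_tensorRight hS y)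
    (fun c hc => h c y hc hy) x⟩

/-- By rigidity `x ⊗ -` is left adjoint to tensoring with the dual of `x`, which preserves
coproducts. -/
theorem compact_tensor {x y : T} (hx : Compact x) (hy : Compact y) : Compact (x ⊗ y) := by
  have := dualExactPairing (hT.dualisable x hx)
  obtain ⟨_, _⟩ := hT.tensorLeft_exact x
  exact hy.map_of_adjunction (tensorLeftAdjunction ((ihom x).obj (𝟙_ T)) x)

theorem compact_dual {x : T} (hx : Compact x) : Compact ((ihom x).obj (𝟙_ T)) := by
  have := dualExactPairing (hT.dualisable x hx)
  have := BraidedCategory.exactPairing_swap ((ihom x).obj (𝟙_ T)) x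
  obtain ⟨_, _⟩ := hT.tensorLeft_exact ((ihom x).obj (𝟙_ T))
  exact (hT.compact_unit.map_of_adjunction
    (tensorLeftAdjunction x ((ihom x).obj (𝟙_ T)))).of_retract (ρ_ _).symm.retract

/-- A localising subcategory generated by a class of compact objects that is closed under tensor
products with compact objects is a tensor ideal. -/
theorem isLocalisingIdeal_loc {F : ObjectProperty T}
    (h : ∀ x y : T, Compact x → F y → F (x ⊗ y)) : IsLocalisingIdeal (loc F) :=
  hT.isLocalisingIdeal_of_compact (isLocalising_loc F) fun x y hx hy =>
    loc_le (hT.isLocalising_tensorLeft (isLocalising_loc F) x)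
      (fun z hz => le_loc F _ (h x z hx hz)) y hy

/-- The right orthogonal of a compactly generated localising tensor ideal is a localising tensor
ideal. -/
theorem isLocalisingIdeal_rightOrthogonal {F : ObjectProperty T} [F.IsStableUnderShift ℤ]
    (hF : F ≤ Compact) (h : ∀ x y : T, Compact x → F y → F (x ⊗ y)) :
    IsLocalisingIdeal (loc F).rightOrthogonal := by
  rw [rightOrthogonal_loc]
  refine hT.isLocalisingIdeal_of_compact (isLocalising_rightOrthogonal hF)
    fun x y hx hy s f hs => ?_
  have := dualExactPairing (hT.dualisable x hx)
  have := BraidedCategory.exactPairing_swap ((ihom x).obj (𝟙_ T)) x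
  have hs' : F ((ihom x).obj (𝟙_ T) ⊗ s) := h _ _ (hT.compact_dual hx) hs
  apply (tensorLeftHomEquiv s x ((ihom x).obj (𝟙_ T)) y).symm.injective
  exact (hy _ hs').trans (hy _ hs').symm

end IsRigidlyCompactlyGenerated

/-- `e ⟶ 𝟙 ⟶ f` is the idempotent triangle of the smashing localising ideal `S`. -/
structure IsIdempotentTriangle (S : ObjectProperty T) (e f : T) : Prop where
  ideal : IsLocalisingIdeal S
  ideal_orthogonal : IsLocalisingIdeal S.rightOrthogonal
  triangle : IsLocalisationTriangle S e (𝟙_ T) f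

theorem isZero_of_rightOrthogonal {S : ObjectProperty T} {x : T} (hx : S x)
    (hx' : S.rightOrthogonal x) : IsZero x :=
  (IsZero.iff_id_eq_zero x).2 (hx' (𝟙 x) hx)

namespace IsIdempotentTriangle

variable {S : ObjectProperty T} {e f : T} (h : IsIdempotentTriangle S e f)
include h

theorem prop_tensor (x : T) : S (e ⊗ x) := by
  have := h.ideal.iso
  exact S.prop_of_iso (β_ x e) (h.ideal.tensor x e h.triangle.1)

theorem rightOrthogonal_tensor (x : T) : S.rightOrthogonal (f ⊗ x) :=
  S.rightOrthogonal.prop_of_iso (β_ x f) (h.ideal_orthogonal.tensor x f h.triangle.2.1)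

variable (hT : IsRigidlyCompactlyGenerated T)
include hT

theorem exists_triangle (x : T) : ∃ (i : e ⊗ x ⟶ x) (p : x ⟶ f ⊗ x)
    (w : f ⊗ x ⟶ (e ⊗ x)⟦(1 : ℤ)⟧), Triangle.mk i p w ∈ distTriang T := by
  obtain ⟨i, p, w, hd⟩ := h.triangle.2.2
  obtain ⟨_, _⟩ := hT.tensorRight_exact x
  refine ⟨i ▷ x ≫ (λ_ x).hom, (λ_ x).inv ≫ p ▷ x,
    w ▷ x ≫ ((tensorRight x).commShiftIso (1 : ℤ)).hom.app e, ?_⟩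
  refine isomorphic_distinguished _ ((tensorRight x).map_distinguished _ hd) _
    (Triangle.isoMk _ _ (Iso.refl _) (λ_ x).symm (Iso.refl _) ?_ ?_ ?_)
  · change (i ▷ x ≫ (λ_ x).hom) ≫ (λ_ x).inv = 𝟙 (e ⊗ x) ≫ i ▷ x
    simp
  · change ((λ_ x).inv ≫ p ▷ x) ≫ 𝟙 (f ⊗ x) = (λ_ x).inv ≫ p ▷ x
    simp
  · change (w ▷ x ≫ ((tensorRight x).commShiftIso (1 : ℤ)).hom.app e) ≫ (𝟙 (e ⊗ x))⟦(1 : ℤ)⟧' =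
      𝟙 (f ⊗ x) ≫ w ▷ x ≫ ((tensorRight x).commShiftIso (1 : ℤ)).hom.app e
    have (k : f ⊗ x ⟶ (e ⊗ x)⟦(1 : ℤ)⟧) : k ≫ (𝟙 (e ⊗ x))⟦(1 : ℤ)⟧' = 𝟙 (f ⊗ x) ≫ k := by simp
    exact this _

theorem localisationTriangle (x : T) : IsLocalisationTriangle S (e ⊗ x) x (f ⊗ x) :=
  ⟨h.prop_tensor x, h.rightOrthogonal_tensor x, h.exists_triangle hT x⟩

theorem nonempty_iso_left {x : T} (hx : IsZero (f ⊗ x)) : Nonempty (e ⊗ x ≅ x) := by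
  obtain ⟨i, p, w, hd⟩ := h.exists_triangle hT x
  have : IsIso i := (Triangle.isZero₃_iff_isIso₁ _ hd).1 hx
  exact ⟨asIso i⟩

theorem nonempty_iso_right {x : T} (hx : IsZero (e ⊗ x)) : Nonempty (f ⊗ x ≅ x) := by
  obtain ⟨i, p, w, hd⟩ := h.exists_triangle hT x
  have : IsIso p := (Triangle.isZero₁_iff_isIso₂ _ hd).1 hx
  exact ⟨(asIso p).symm⟩

theorem prop_iff (x : T) : S x ↔ IsZero (f ⊗ x) := by
  refine ⟨fun hx => isZero_of_rightOrthogonal (h.ideal.tensor f x hx)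
    (h.rightOrthogonal_tensor x), fun hx => ?_⟩
  obtain ⟨i⟩ := h.nonempty_iso_left hT hx
  have := h.ideal.iso
  exact S.prop_of_iso i (h.prop_tensor x)

theorem rightOrthogonal_iff (x : T) : S.rightOrthogonal x ↔ IsZero (e ⊗ x) := by
  refine ⟨fun hx => isZero_of_rightOrthogonal (h.prop_tensor x)
    (h.ideal_orthogonal.tensor e x hx), fun hx => ?_⟩
  obtain ⟨i⟩ := h.nonempty_iso_right hT hx
  exact S.rightOrthogonal.prop_of_iso i (h.rightOrthogonal_tensor x)

/-- Tensoring the given triangle with `e` kills `b`, and tensoring it with `f` kills `a`. -/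
theorem nonempty_iso_of_localisationTriangle {a x b : T}
    (ht : IsLocalisationTriangle S a x b) :
    Nonempty (a ≅ e ⊗ x) ∧ Nonempty (b ≅ f ⊗ x) := by
  obtain ⟨ha, hb, i, p, w, hd⟩ := ht
  rw [h.rightOrthogonal_iff hT] at hb
  rw [h.prop_iff hT] at ha
  obtain ⟨u⟩ := h.nonempty_iso_left hT ha
  obtain ⟨u'⟩ := h.nonempty_iso_right hT hb
  constructor
  · obtain ⟨_, _⟩ := hT.tensorLeft_exact e
    have : IsIso ((tensorLeft e).map i) :=
      (Triangle.isZero₃_iff_isIso₁ _ ((tensorLeft e).map_distinguished _ hd)).1 hb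
    exact ⟨u.symm ≪≫ asIso ((tensorLeft e).map i)⟩
  · obtain ⟨_, _⟩ := hT.tensorLeft_exact f
    have : IsIso ((tensorLeft f).map p) :=
      (Triangle.isZero₁_iff_isIso₂ _ ((tensorLeft f).map_distinguished _ hd)).1 ha
    exact ⟨u'.symm ≪≫ (asIso ((tensorLeft f).map p)).symm⟩

end IsIdempotentTriangle

end TensorTriangulated

/-! ### Thick ideals, primes and Thomason subsets. -/

section TensorTriangulated

variable {T : Type u} [Category.{v} T] [HasZeroObject T] [Preadditive T] [HasShift T ℤ]
  [∀ n : ℤ, (shiftFunctor T n).Additive] [Pretriangulated T] [HasCoproducts.{v} T]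

open scoped ZeroObject

theorem isZero_eq_leftOrthogonal_top :
    (fun x : T => IsZero x) = (⊤ : ObjectProperty T).leftOrthogonal := by
  ext x
  exact ⟨fun hx y f _ => hx.eq_of_src f 0,
    fun hx => (IsZero.iff_id_eq_zero x).2 (hx (𝟙 x) trivial)⟩

theorem isLocalising_isZero : IsLocalising fun x : T => IsZero x := by
  rw [isZero_eq_leftOrthogonal_top]
  exact isLocalising_leftOrthogonal _

instance : ObjectProperty.IsStableUnderRetracts fun x : T => IsZero x where
  of_retract r hy := (IsZero.iff_id_eq_zero _).2 <| by
    rw [← r.retract, hy.eq_of_tgt r.i 0, zero_comp]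

variable [MonoidalCategory T]

/-- Thick tensor ideals of the category of compact objects. -/
structure IsThickIdeal (I : ObjectProperty T) : Prop where
  le_compact : I ≤ Compact
  triangulated : I.IsTriangulated
  retracts : I.IsStableUnderRetracts
  tensor : ∀ x y : T, Compact x → I y → I (x ⊗ y)

theorem isThickIdeal_sSup {A : Set (ObjectProperty T)} (hA : ∀ I ∈ A, IsThickIdeal I)
    (hne : A.Nonempty) (hc : IsChain (· ≤ ·) A) : IsThickIdeal (sSup A) := by
  have hprop (x : T) : sSup A x ↔ ∃ I ∈ A, I x := by simp
  have hret : (sSup A).IsStableUnderRetracts := ⟨fun r hy => by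
    obtain ⟨I, hI, h⟩ := (hprop _).1 hy
    have := (hA I hI).retracts
    exact (hprop _).2 ⟨I, hI, I.prop_of_retract r h⟩⟩
  refine ⟨fun x hx => ?_, { exists_zero := ⟨0, isZero_zero T, ?_⟩
                            isStableUnderShiftBy := fun n => ⟨fun x hx => ?_⟩
                            ext₂' := ?_ }, hret, fun x y hx hy => ?_⟩
  · obtain ⟨I, hI, h⟩ := (hprop _).1 hx
    exact (hA I hI).le_compact x h
  · obtain ⟨I, hI⟩ := hne
    have := (hA I hI).triangulated
    have := (hA I hI).retracts
    exact (hprop _).2 ⟨I, hI, I.prop_zero⟩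
  · obtain ⟨I, hI, h⟩ := (hprop _).1 hx
    have := (hA I hI).triangulated
    exact (hprop _).2 ⟨I, hI, I.le_shift n x h⟩
  · rw [ObjectProperty.isoClosure_eq_self]
    intro t ht h₁ h₃
    obtain ⟨I, hI, h₁⟩ := (hprop _).1 h₁
    obtain ⟨J, hJ, h₃⟩ := (hprop _).1 h₃
    obtain ⟨K, hK, hIK, hJK⟩ : ∃ K ∈ A, I ≤ K ∧ J ≤ K := by
      rcases hc.total hI hJ with h | h
      · exact ⟨J, hJ, h, le_rfl⟩
      · exact ⟨I, hI, le_rfl, h⟩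
    have := (hA K hK).triangulated
    have := (hA K hK).retracts
    exact (hprop _).2 ⟨K, hK, K.ext_of_isTriangulatedClosed₂ t ht (hIK _ h₁) (hJK _ h₃)⟩
  · obtain ⟨I, hI, h⟩ := (hprop _).1 hy
    exact (hprop _).2 ⟨I, hI, (hA I hI).tensor x y hx h⟩

theorem tauCompact_le_compact (V : Set (Spc T)) : tauCompact V ≤ Compact := fun _ hx => hx.1

instance (V : Set (Spc T)) : (tauCompact V).IsStableUnderRetracts where
  of_retract r hy := ⟨hy.1.of_retract r, fun P hP => hy.2 P fun h => hP <| by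
    have := P.retracts
    exact P.carrier.prop_of_retract r h⟩

instance (V : Set (Spc T)) : (tauCompact V).IsTriangulated where
  exists_zero := ⟨0, isZero_zero T, compact_of_isZero (isZero_zero T), fun P hP => by
    have := P.triangulated
    have := P.retracts
    exact (hP P.carrier.prop_zero).elim⟩
  isStableUnderShiftBy n := ⟨fun x hx => ⟨Compact.le_shift n x hx.1, fun P hP =>
    hx.2 P fun h => hP <| by
    have := P.triangulated
    exact P.carrier.le_shift n x h⟩⟩
  ext₂' := by
    rw [ObjectProperty.isoClosure_eq_self]
    intro t ht h₁ h₃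
    refine ⟨Compact.ext_of_isTriangulatedClosed₂ t ht h₁.1 h₃.1, fun P hP => ?_⟩
    have := P.triangulated
    have := P.retracts
    by_cases h : P.carrier t.obj₁
    · exact h₃.2 P fun h' => hP (P.carrier.ext_of_isTriangulatedClosed₂ t ht h h')
    · exact h₁.2 P h

theorem tauCompact_mono {U V : Set (Spc T)} (h : U ⊆ V) : tauCompact U ≤ tauCompact V :=
  fun _ hx => ⟨hx.1, fun P hP => h (hx.2 P hP)⟩

theorem locOpen_mono {U V : Set (Spc T)} (h : U ⊆ V) : locOpen U ≤ locOpen V :=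
  loc_mono (tauCompact_mono h)

/-- The compact objects of `T_V` are the compact objects supported on `V`. -/
theorem tauCompact_of_locOpen {V : Set (Spc T)} {x : T} (hx : Compact x) (h : locOpen V x) :
    tauCompact V x :=
  prop_of_compact_of_loc (tauCompact_le_compact V) hx h

theorem Spc.prop_biprod_iff (P : Spc T) {x y : T} :
    P.carrier (x ⊞ y) ↔ P.carrier x ∧ P.carrier y := by
  have := P.triangulated
  have := P.retracts
  exact ⟨fun h => ⟨ObjectProperty.IsStableUnderRetracts.of_biprod_left _ h,
    ObjectProperty.IsStableUnderRetracts.of_biprod_right _ h⟩, fun h => prop_biprod _ h.1 h.2⟩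

theorem Spc.not_prop_unit (P : Spc T) : ¬ P.carrier (𝟙_ T) := fun h => by
  obtain ⟨x, hx, hxP⟩ := P.proper
  have := P.retracts
  exact hxP (P.carrier.prop_of_iso (ρ_ x) (P.tensor x _ hx h))

/-- Finite intersections of the generating sets are again of this form, via direct sums. -/
theorem Spc.isTopologicalBasis : TopologicalSpace.IsTopologicalBasis
    {U | ∃ x : T, Compact x ∧ U = {P : Spc T | P.carrier x}} where
  exists_subset_inter := by
    rintro _ ⟨x, hx, rfl⟩ _ ⟨y, hy, rfl⟩ P ⟨hPx, hPy⟩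
    exact ⟨_, ⟨x ⊞ y, prop_biprod _ hx hy, rfl⟩, P.prop_biprod_iff.2 ⟨hPx, hPy⟩,
      fun Q hQ => Q.prop_biprod_iff.1 hQ⟩
  sUnion_eq := by
    refine Set.eq_univ_of_forall fun P => ⟨_, ⟨0, compact_of_isZero (isZero_zero T), rfl⟩, ?_⟩
    have := P.triangulated
    have := P.retracts
    exact P.carrier.prop_zero
  eq_generateFrom := rfl

variable [SymmetricCategory T] [MonoidalClosed T]

namespace IsRigidlyCompactlyGenerated

variable (hT : IsRigidlyCompactlyGenerated T)
include hT

theorem tauCompact_tensor {V : Set (Spc T)} {x y : T} (hx : Compact x) (hy : tauCompact V y) :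
    tauCompact V (x ⊗ y) :=
  ⟨hT.compact_tensor hx hy.1, fun P hP => hy.2 P fun h => hP (P.tensor x y hx h)⟩

theorem tauCompact_inter {V W : Set (Spc T)} {x y : T} (hx : tauCompact V x)
    (hy : tauCompact W y) : tauCompact (V ∩ W) (x ⊗ y) := by
  refine ⟨hT.compact_tensor hx.1 hy.1, fun P hP => ⟨hx.2 P fun h => hP ?_,
    hy.2 P fun h => hP (P.tensor x y hx.1 h)⟩⟩
  have := P.retracts
  exact P.carrier.prop_of_iso (β_ y x) (P.tensor y x hy.1 h)

/-- The colon of a thick tensor ideal by an object. -/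
theorem isThickIdeal_colon {Q : ObjectProperty T} [Q.IsTriangulated] [Q.IsStableUnderRetracts]
    (hQ : ∀ x y : T, Compact x → Q y → Q (x ⊗ y)) (z : T) :
    IsThickIdeal fun t : T => Compact t ∧ Q (t ⊗ z) := by
  obtain ⟨_, _⟩ := hT.tensorRight_exact z
  have hret : ObjectProperty.IsStableUnderRetracts fun t : T => Compact t ∧ Q (t ⊗ z) :=
    ⟨fun r h => ⟨h.1.of_retract r, Q.prop_of_retract (r.map (tensorRight z)) h.2⟩⟩
  refine ⟨fun t ht => ht.1,
    { exists_zero := ⟨0, isZero_zero T, compact_of_isZero (isZero_zero T),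
        Q.prop_of_isZero ((tensorRight z).map_isZero (isZero_zero T))⟩
      isStableUnderShiftBy := fun n => ⟨fun x hx => ⟨Compact.le_shift n x hx.1,
        Q.prop_of_iso (((tensorRight z).commShiftIso n).app x).symm (Q.le_shift n _ hx.2)⟩⟩
      ext₂' := ?_ }, hret, fun x y hx hy => ⟨hT.compact_tensor hx hy.1,
        Q.prop_of_iso (α_ x y z).symm (hQ x _ hx hy.2)⟩⟩
  rw [ObjectProperty.isoClosure_eq_self]
  intro t ht h₁ h₃
  exact ⟨Compact.ext_of_isTriangulatedClosed₂ t ht h₁.1 h₃.1,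
    Q.ext_of_isTriangulatedClosed₂ _ ((tensorRight z).map_distinguished t ht) h₁.2 h₃.2⟩

/-- Thick tensor ideals are radical, by rigidity. -/
theorem prop_of_tensor_self {I : ObjectProperty T} (hI : IsThickIdeal I) {x : T}
    (hx : Compact x) (h : I (x ⊗ x)) : I x := by
  have := hI.retracts
  let d := (ihom x).obj (𝟙_ T)
  refine I.prop_of_retract (dualRetract (hT.dualisable x hx)) ?_
  exact I.prop_of_iso ((α_ d x x).symm ≪≫ whiskerRightIso (β_ d x) x)
    (hI.tensor d _ (hT.compact_dual hx) h)

/-- Every proper thick tensor ideal is contained in a prime avoiding a given object outside it. -/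
theorem exists_prime {I : ObjectProperty T} (hI : IsThickIdeal I) {x : T} (hx : Compact x)
    (hxI : ¬ I x) : ∃ P : Spc T, I ≤ P.carrier ∧ ¬ P.carrier x := by
  obtain ⟨J, hIJ, hJ⟩ := zorn_le_nonempty₀ {J : ObjectProperty T | IsThickIdeal J ∧ ¬ J x}
    (fun A hA hc J hJ => ⟨sSup A, ⟨isThickIdeal_sSup (fun K hK => (hA hK).1) ⟨J, hJ⟩ hc, by
      simpa using fun K hK => (hA hK).2⟩, fun K hK => le_sSup hK⟩) I ⟨hI, hxI⟩
  have hJi : IsThickIdeal J := hJ.prop.1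
  have := hJi.triangulated
  have := hJi.retracts
  -- The colon of `J` by `z` contains `J`; if it avoided `x`, maximality would force it into `J`.
  -- Two applications put `x ⊗ x` in `J`, contradicting radicality.
  have hcolon (z y : T) (hz : Compact z) (hy : Compact y) (hyz : J (y ⊗ z)) (hyJ : ¬ J y) :
      J (x ⊗ z) := by
    by_contra hxz
    have hK := hT.isThickIdeal_colon hJi.tensor z
    have hle := hJ.le_of_ge (y := fun t => Compact t ∧ J (t ⊗ z))
      ⟨hK, fun h => hxz h.2⟩ fun t ht =>
        ⟨hJi.le_compact t ht, J.prop_of_iso (β_ z t) (hJi.tensor z t hz ht)⟩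
    exact hyJ (hle y ⟨hy, hyz⟩)
  refine ⟨⟨J, hJi.le_compact, hJi.triangulated, hJi.retracts, hJi.tensor, ⟨x, hx, hJ.prop.2⟩,
    fun a b ha hb hab => ?_⟩, hIJ, hJ.prop.2⟩
  by_contra! hn
  have h₁ : J (x ⊗ b) := hcolon b a hb ha hab hn.1
  have h₂ : J (x ⊗ x) := hcolon x b hx hb (J.prop_of_iso (β_ x b) h₁) hn.2
  exact hJ.prop.2 (hT.prop_of_tensor_self hJi hx h₂)

/-- Each point of a Thomason subset lies in the support of a compact object supported on it. -/
theorem exists_tauCompact_of_mem {V : Set (Spc T)} (hV : IsThomason V) {P : Spc T}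
    (hP : P ∈ V) : ∃ x : T, tauCompact V x ∧ ¬ P.carrier x := by
  obtain ⟨F, hF, rfl⟩ := hV
  obtain ⟨W, hW, hPW⟩ := hP
  obtain ⟨ho, hc⟩ := hF W hW
  obtain ⟨x, hx, h₁, h₂⟩ : ∃ x : T, Compact x ∧ (∀ Q ∈ Wᶜ, Q.carrier x) ∧
      ∀ Q : Spc T, Q.carrier x → Q ∈ Wᶜ := by
    -- Compact induction produces `x` with `Wᶜ = {Q | Q.carrier x}`: finite unions of basic open
    -- sets become tensor products, by primality.
    refine hc.induction_on (p := fun s => ∃ x : T, Compact x ∧ (∀ Q ∈ s, Q.carrier x) ∧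
      ∀ Q : Spc T, Q.carrier x → Q ∈ Wᶜ)
      ⟨𝟙_ T, hT.compact_unit, by simp, fun Q hQ => (Q.not_prop_unit hQ).elim⟩ ?_ ?_ ?_
    · rintro s t hst ⟨x, hx, h₁, h₂⟩
      exact ⟨x, hx, fun Q hQ => h₁ Q (hst hQ), h₂⟩
    · rintro s t ⟨x, hx, h₁, h₂⟩ ⟨y, hy, h₃, h₄⟩
      refine ⟨x ⊗ y, hT.compact_tensor hx hy, ?_, fun Q hQ => ?_⟩
      · rintro Q (hQ | hQ)
        · have := Q.retracts
          exact Q.carrier.prop_of_iso (β_ y x) (Q.tensor y x hy (h₁ Q hQ))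
        · exact Q.tensor x y hx (h₃ Q hQ)
      · exact (Q.prime x y hx hy hQ).elim (h₂ Q) (h₄ Q)
    · intro Q hQ
      obtain ⟨_, ⟨x, hx, rfl⟩, hQx, hsub⟩ :=
        Spc.isTopologicalBasis.exists_subset_of_mem_open hQ ho
      exact ⟨_, mem_nhdsWithin_of_mem_nhds
        ((Spc.isTopologicalBasis.isOpen ⟨x, hx, rfl⟩).mem_nhds hQx), x, hx, fun _ h => h,
        fun _ h => hsub h⟩
  exact ⟨x, ⟨hx, fun Q hQ => ⟨W, hW, by_contra fun h => hQ (h₁ Q h)⟩⟩, fun h => h₂ P h hPW⟩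

/-- An object annihilating the compact objects supported on `U` and those supported on `U'`
annihilates `T_W` for `W ⊆ U ∪ U'`. -/
theorem isZero_tensor_of_subset_union {U U' W : Set (Spc T)} (hU : IsThomason U)
    (hU' : IsThomason U') (hW : W ⊆ U ∪ U') {z : T}
    (h : ∀ t, tauCompact U t → IsZero (t ⊗ z)) (h' : ∀ t, tauCompact U' t → IsZero (t ⊗ z))
    {x : T} (hx : locOpen W x) : IsZero (x ⊗ z) := by
  refine loc_le (hT.isLocalising_tensorRight isLocalising_isZero z) (fun t ht => ?_) x hx
  by_contra hn
  have : ObjectProperty.IsTriangulated fun x : T => IsZero x := isLocalising_isZero.triangulated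
  -- A prime containing the annihilator of `z` but not `t` lies in `U ∪ U'`, yet there some
  -- annihilating compact object lies outside it.
  obtain ⟨P, hIP, hP⟩ := hT.exists_prime
    (hT.isThickIdeal_colon (Q := fun x => IsZero x) (fun x y _ => hT.isZero_tensor_right x) z)
    ht.1 (fun h => hn h.2)
  rcases hW (ht.2 P hP) with hPU | hPU
  · obtain ⟨w, hw, hwP⟩ := hT.exists_tauCompact_of_mem hU hPU
    exact hwP (hIP w ⟨hw.1, h w hw⟩)
  · obtain ⟨w, hw, hwP⟩ := hT.exists_tauCompact_of_mem hU' hPU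
    exact hwP (hIP w ⟨hw.1, h' w hw⟩)

variable [IsTriangulated T]

theorem exists_isIdempotentTriangle (V : Set (Spc T)) :
    ∃ e f, IsIdempotentTriangle (locOpen V) e f := by
  have := essentiallySmall_compact hT.compactlyGenerated
  have : ObjectProperty.EssentiallySmall.{v} (tauCompact V) :=
    .of_le (tauCompact_le_compact V)
  obtain ⟨e, f, h⟩ := exists_isLocalisationTriangle (tauCompact_le_compact V) (𝟙_ T)
  exact ⟨e, f, hT.isLocalisingIdeal_loc fun x y => hT.tauCompact_tensor,
    hT.isLocalisingIdeal_rightOrthogonal (tauCompact_le_compact V)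
      fun x y => hT.tauCompact_tensor, h⟩

/-- A prime is determined by its trace on a small skeleton of the compact objects. This permits
coproducts indexed by points. -/
theorem small_spc : Small.{v} (Spc T) := by
  have := essentiallySmall_compact hT.compactlyGenerated
  obtain ⟨Q, _, hQ, hQ'⟩ :=
    ObjectProperty.EssentiallySmall.exists_small_le.{v} (Compact : ObjectProperty T)
  refine small_of_injective (β := Set (Subtype Q)) (f := fun P => {q | P.carrier q.1}) ?_
  intro P P' h
  ext x
  have hx (hx : Compact x) : P.carrier x ↔ P'.carrier x := by
    obtain ⟨y, hy, ⟨e⟩⟩ := hQ' x hx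
    have := P.retracts
    have := P'.retracts
    rw [P.carrier.prop_iff_of_iso e, P'.carrier.prop_iff_of_iso e]
    exact Set.ext_iff.1 h ⟨y, hy⟩
  exact ⟨fun h => (hx (P.le_compact x h)).1 h, fun h => (hx (P'.le_compact x h)).2 h⟩

end IsRigidlyCompactlyGenerated

end TensorTriangulated

/-! ### The idempotents `Γ_p 𝟙` and the strata. -/

section TensorTriangulated

variable {T : Type u} [Category.{v} T] [HasZeroObject T] [Preadditive T] [HasShift T ℤ]
  [∀ n : ℤ, (shiftFunctor T n).Additive] [Pretriangulated T] [IsTriangulated T]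
  [HasCoproducts.{v} T] [MonoidalCategory T] [SymmetricCategory T] [MonoidalClosed T]

open scoped ZeroObject

/-- A Thomason subset `U` with `{p} = V ∖ U`. -/
noncomputable def PointsLocallyClosed.lower (hlc : PointsLocallyClosed T) (p : Spc T) :
    Set (Spc T) :=
  (hlc p).choose

/-- A Thomason subset `V` with `{p} = V ∖ U`. -/
noncomputable def PointsLocallyClosed.upper (hlc : PointsLocallyClosed T) (p : Spc T) :
    Set (Spc T) :=
  (hlc p).choose_spec.choose

theorem PointsLocallyClosed.exhibitsPoint (hlc : PointsLocallyClosed T) (p : Spc T) :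
    ExhibitsPoint p (hlc.lower p) (hlc.upper p) :=
  (hlc p).choose_spec.choose_spec

namespace IsRigidlyCompactlyGenerated

variable (hT : IsRigidlyCompactlyGenerated T)

/-- The left idempotent `Γ_V 𝟙`. -/
noncomputable def gammaUnit (V : Set (Spc T)) : T :=
  (hT.exists_isIdempotentTriangle V).choose

/-- The right idempotent `L_V 𝟙`. -/
noncomputable def localUnit (V : Set (Spc T)) : T :=
  (hT.exists_isIdempotentTriangle V).choose_spec.choose

theorem isIdempotentTriangle (V : Set (Spc T)) :
    IsIdempotentTriangle (locOpen V) (hT.gammaUnit V) (hT.localUnit V) :=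
  (hT.exists_isIdempotentTriangle V).choose_spec.choose_spec

/-- Isomorphism classes form a commutative monoid under `⊗`, so chains of associators and braidings
become monoid equations. -/
theorem isZero_iff_toSkeleton (x : T) : IsZero x ↔ toSkeleton x = toSkeleton (0 : T) := by
  rw [toSkeleton_eq_toSkeleton_iff]
  exact ⟨fun h => ⟨h.iso (isZero_zero T)⟩, fun ⟨e⟩ => (isZero_zero T).of_iso e⟩

/-- The object `Γ_V L_U 𝟙`. -/
noncomputable def gammaLocal (U V : Set (Spc T)) : T := hT.gammaUnit V ⊗ hT.localUnit U

include hT in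
theorem locOpen_inter_tensor {V V' : Set (Spc T)} {x y : T} (hx : locOpen V x)
    (hy : locOpen V' y) : locOpen (V ∩ V') (x ⊗ y) :=
  loc_le (hT.isLocalising_tensorRight (isLocalising_loc _) y) (fun t ht =>
    loc_le (hT.isLocalising_tensorLeft (isLocalising_loc _) t)
      (fun _ hs => le_loc _ _ (hT.tauCompact_inter ht hs)) y hy) x hx

/-- `T_W` is annihilated by `L_U ∘ L_{U'}` if `W ⊆ U ∪ U'`. -/
theorem isZero_tensor_localUnit {U U' W : Set (Spc T)} (hU : IsThomason U)
    (hU' : IsThomason U') (hW : W ⊆ U ∪ U') {x : T} (hx : locOpen W x) :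
    IsZero (x ⊗ (hT.localUnit U ⊗ hT.localUnit U')) := by
  refine hT.isZero_tensor_of_subset_union hU hU' hW (fun t ht => ?_) (fun t ht => ?_) hx
  · have h := ((hT.isIdempotentTriangle U).prop_iff hT t).1 (le_loc _ t ht)
    rw [isZero_iff_toSkeleton] at h ⊢
    have h0 := (isZero_iff_toSkeleton _).1
      (hT.isZero_tensor_left (isZero_zero T) (hT.localUnit U'))
    simp only [Skeleton.toSkeleton_tensorObj] at h h0 ⊢
    rw [← mul_assoc, mul_comm (toSkeleton t), h, h0]
  · have h := ((hT.isIdempotentTriangle U').prop_iff hT t).1 (le_loc _ t ht)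
    rw [isZero_iff_toSkeleton] at h ⊢
    have h0 := (isZero_iff_toSkeleton _).1
      (hT.isZero_tensor_left (isZero_zero T) (hT.localUnit U))
    simp only [Skeleton.toSkeleton_tensorObj] at h h0 ⊢
    rw [mul_comm (toSkeleton (hT.localUnit U)), ← mul_assoc, mul_comm (toSkeleton t), h, h0]

theorem toSkeleton_gammaUnit_mul {V : Set (Spc T)} {x : T}
    (h : toSkeleton (hT.localUnit V) * toSkeleton x = toSkeleton (0 : T)) :
    toSkeleton (hT.gammaUnit V) * toSkeleton x = toSkeleton x := by
  rw [← Skeleton.toSkeleton_tensorObj, ← isZero_iff_toSkeleton] at h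
  rw [← Skeleton.toSkeleton_tensorObj, toSkeleton_eq_toSkeleton_iff]
  exact (hT.isIdempotentTriangle V).nonempty_iso_left hT h

theorem toSkeleton_localUnit_mul {V : Set (Spc T)} {x : T}
    (h : toSkeleton (hT.gammaUnit V) * toSkeleton x = toSkeleton (0 : T)) :
    toSkeleton (hT.localUnit V) * toSkeleton x = toSkeleton x := by
  rw [← Skeleton.toSkeleton_tensorObj, ← isZero_iff_toSkeleton] at h
  rw [← Skeleton.toSkeleton_tensorObj, toSkeleton_eq_toSkeleton_iff]
  exact (hT.isIdempotentTriangle V).nonempty_iso_right hT h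

/-- Since `V ⊆ U ∪ V'` and `U' ∩ V ⊆ U`, both `L_{V'}` and `Γ_{U'}` kill `Γ_V L_U 𝟙`; hence `Γ_{V'}`
and `L_{U'}` fix it. -/
theorem toSkeleton_gammaLocal_mul {p : Spc T} {U V U' V' : Set (Spc T)}
    (h : ExhibitsPoint p U V) (h' : ExhibitsPoint p U' V') :
    toSkeleton (hT.gammaLocal U' V') * toSkeleton (hT.gammaLocal U V) =
      toSkeleton (hT.gammaLocal U V) := by
  obtain ⟨hU, hV, hp⟩ := h
  obtain ⟨hU', hV', hp'⟩ := h'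
  have hpV' : p ∈ V' := (hp'.symm.subset rfl).1
  have hpU' : p ∉ U' := (hp'.symm.subset rfl).2
  have h₁ : toSkeleton (hT.localUnit V') * toSkeleton (hT.gammaLocal U V) =
      toSkeleton (0 : T) := by
    have := hT.isZero_tensor_localUnit (W := V) hU hV' (fun q hq => by
      by_cases hqU : q ∈ U
      · exact Or.inl hqU
      · have : q ∈ ({p} : Set (Spc T)) := hp ▸ ⟨hq, hqU⟩
        rw [Set.mem_singleton_iff.1 this]
        exact Or.inr hpV') (hT.isIdempotentTriangle V).triangle.1
    rw [isZero_iff_toSkeleton] at this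
    rw [← this, gammaLocal]
    simp only [Skeleton.toSkeleton_tensorObj]
    ac_rfl
  have h₂ : toSkeleton (hT.gammaUnit U') * toSkeleton (hT.gammaLocal U V) =
      toSkeleton (0 : T) := by
    have := locOpen_mono (V := U) (fun q hq => by
      by_contra hqU
      have h2 : q ∈ ({p} : Set (Spc T)) := hp ▸ ⟨hq.2, hqU⟩
      rw [Set.mem_singleton_iff.1 h2] at hq
      exact hpU' hq.1) _
      (hT.locOpen_inter_tensor (hT.isIdempotentTriangle U').triangle.1
        (hT.isIdempotentTriangle V).triangle.1)
    rw [(hT.isIdempotentTriangle U).prop_iff hT, isZero_iff_toSkeleton] at this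
    rw [← this, gammaLocal]
    simp only [Skeleton.toSkeleton_tensorObj]
    ac_rfl
  conv_lhs => rw [gammaLocal]
  rw [Skeleton.toSkeleton_tensorObj, mul_assoc, hT.toSkeleton_localUnit_mul h₂,
    hT.toSkeleton_gammaUnit_mul h₁]

theorem toSkeleton_gammaLocal_eq {p : Spc T} {U V U' V' : Set (Spc T)}
    (h : ExhibitsPoint p U V) (h' : ExhibitsPoint p U' V') :
    toSkeleton (hT.gammaLocal U V) = toSkeleton (hT.gammaLocal U' V') := by
  rw [← hT.toSkeleton_gammaLocal_mul h h', mul_comm, hT.toSkeleton_gammaLocal_mul h' h]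

/-- For distinct points `V ∩ V' ⊆ U ∪ U'`, so `L_U L_{U'}` annihilates `Γ_V 𝟙 ⊗ Γ_{V'} 𝟙`. -/
theorem isZero_gammaLocal_tensor {p q : Spc T} (hpq : p ≠ q) {U V U' V' : Set (Spc T)}
    (h : ExhibitsPoint p U V) (h' : ExhibitsPoint q U' V') :
    IsZero (hT.gammaLocal U V ⊗ hT.gammaLocal U' V') := by
  obtain ⟨hU, hV, hp⟩ := h
  obtain ⟨hU', hV', hq⟩ := h'
  have := hT.isZero_tensor_localUnit (W := V ∩ V') hU hU' (fun r hr => by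
    by_contra hn
    rw [Set.mem_union, not_or] at hn
    have h₁ : r ∈ ({p} : Set (Spc T)) := hp ▸ ⟨hr.1, hn.1⟩
    have h₂ : r ∈ ({q} : Set (Spc T)) := hq ▸ ⟨hr.2, hn.2⟩
    exact hpq ((Set.mem_singleton_iff.1 h₁).symm.trans (Set.mem_singleton_iff.1 h₂)))
    (hT.locOpen_inter_tensor (hT.isIdempotentTriangle V).triangle.1
        (hT.isIdempotentTriangle V').triangle.1)
  rw [isZero_iff_toSkeleton] at this ⊢
  rw [← this, gammaLocal, gammaLocal]
  simp only [Skeleton.toSkeleton_tensorObj]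
  ac_rfl

/-- Otherwise `L_U` kills every compact object supported on `V`, including one with `p` in its
support. Neeman's theorem would then give `p ∈ U`. -/
theorem not_isZero_gammaLocal {p : Spc T} {U V : Set (Spc T)} (h : ExhibitsPoint p U V) :
    ¬ IsZero (hT.gammaLocal U V) := by
  intro h0
  obtain ⟨hU, hV, hp⟩ := h
  have hpV : p ∈ V := (hp.symm.subset rfl).1
  have hpU : p ∉ U := (hp.symm.subset rfl).2
  obtain ⟨x, hx, hxp⟩ := hT.exists_tauCompact_of_mem hV hpV
  have h₁ := ((hT.isIdempotentTriangle V).prop_iff hT x).1 (le_loc _ _ hx)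
  have h₂ : locOpen U x := by
    rw [(hT.isIdempotentTriangle U).prop_iff hT]
    rw [isZero_iff_toSkeleton] at h₁ ⊢
    rw [Skeleton.toSkeleton_tensorObj] at h₁ ⊢
    rw [← hT.toSkeleton_gammaUnit_mul h₁, ← mul_assoc, mul_comm (toSkeleton (hT.localUnit U)),
      ← Skeleton.toSkeleton_tensorObj, ← Skeleton.toSkeleton_tensorObj, ← isZero_iff_toSkeleton]
    exact hT.isZero_tensor_left h0 x
  exact hpU ((tauCompact_of_locOpen hx.1 h₂).2 p hxp)

variable (hlc : PointsLocallyClosed T)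

/-- The object `Γ_p 𝟙`. -/
noncomputable def gammaPoint (p : Spc T) : T :=
  hT.gammaLocal (hlc.lower p) (hlc.upper p)

theorem isLocalCohomology_iff (p : Spc T) (x y : T) :
    IsLocalCohomology p x y ↔ Nonempty (y ≅ hT.gammaPoint hlc p ⊗ x) := by
  rw [← toSkeleton_eq_toSkeleton_iff, Skeleton.toSkeleton_tensorObj]
  constructor
  · rintro ⟨U, V, h, a, z, b, ht₁, ht₂⟩
    have h₁ := ((hT.isIdempotentTriangle U).nonempty_iso_of_localisationTriangle hT ht₁).2
    have h₂ := ((hT.isIdempotentTriangle V).nonempty_iso_of_localisationTriangle hT ht₂).1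
    rw [← toSkeleton_eq_toSkeleton_iff, Skeleton.toSkeleton_tensorObj] at h₁ h₂
    rw [gammaPoint, hT.toSkeleton_gammaLocal_eq (hlc.exhibitsPoint p) h, h₂, h₁,
      gammaLocal, Skeleton.toSkeleton_tensorObj, mul_assoc]
  · intro h
    have hp := hlc.exhibitsPoint p
    refine ⟨_, _, hp, _, _, hT.localUnit (hlc.upper p) ⊗ (hT.localUnit (hlc.lower p) ⊗ x),
      (hT.isIdempotentTriangle _).localisationTriangle hT x, ?_⟩
    obtain ⟨h₁, h₂, i, q, w, hd⟩ := (hT.isIdempotentTriangle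
      (hlc.upper p)).localisationTriangle hT (hT.localUnit (hlc.lower p) ⊗ x)
    obtain ⟨e⟩ : Nonempty (y ≅ hT.gammaUnit (hlc.upper p) ⊗
        (hT.localUnit (hlc.lower p) ⊗ x)) := by
      rw [← toSkeleton_eq_toSkeleton_iff, h, gammaPoint, gammaLocal]
      simp only [Skeleton.toSkeleton_tensorObj, mul_assoc]
    have := (isLocalising_loc (tauCompact (hlc.upper p))).iso
    refine ⟨(loc _).prop_of_iso e.symm h₁, h₂, e.hom ≫ i, q, w ≫ e.inv⟦(1 : ℤ)⟧',
      isomorphic_distinguished _ hd _ (Triangle.isoMk _ _ e (Iso.refl _) (Iso.refl _) ?_ ?_ ?_)⟩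
    · exact Category.comp_id _
    · exact (Category.comp_id q).trans (Category.id_comp q).symm
    · change (w ≫ e.inv⟦(1 : ℤ)⟧') ≫ e.hom⟦(1 : ℤ)⟧' = 𝟙 _ ≫ w
      rw [Category.assoc, ← Functor.map_comp, e.inv_hom_id]
      simp

theorem mem_supp_iff (p : Spc T) (x : T) :
    p ∈ supp x ↔ ¬ IsZero (hT.gammaPoint hlc p ⊗ x) := by
  constructor
  · rintro ⟨y, hy, hy0⟩ h0
    obtain ⟨e⟩ := (hT.isLocalCohomology_iff hlc p x y).1 hy
    exact hy0 (h0.of_iso e)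
  · intro h
    exact ⟨_, (hT.isLocalCohomology_iff hlc p x _).2 ⟨Iso.refl _⟩, h⟩

theorem stratum_iff (p : Spc T) (x : T) :
    stratum p x ↔ Nonempty (hT.gammaPoint hlc p ⊗ x ≅ x) := by
  rw [← toSkeleton_eq_toSkeleton_iff, Skeleton.toSkeleton_tensorObj]
  constructor
  · rintro ⟨U, V, h, hx, hx'⟩
    rw [(hT.isIdempotentTriangle V).prop_iff hT, isZero_iff_toSkeleton,
      Skeleton.toSkeleton_tensorObj] at hx
    rw [(hT.isIdempotentTriangle U).rightOrthogonal_iff hT, isZero_iff_toSkeleton,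
      Skeleton.toSkeleton_tensorObj] at hx'
    rw [gammaPoint, hT.toSkeleton_gammaLocal_eq (hlc.exhibitsPoint p) h, gammaLocal,
      Skeleton.toSkeleton_tensorObj, mul_assoc, hT.toSkeleton_localUnit_mul hx',
      hT.toSkeleton_gammaUnit_mul hx]
  · intro h
    rw [← Skeleton.toSkeleton_tensorObj, toSkeleton_eq_toSkeleton_iff] at h
    obtain ⟨e⟩ := h
    have hV := hT.isIdempotentTriangle (hlc.upper p)
    have hU := hT.isIdempotentTriangle (hlc.lower p)
    refine ⟨_, _, hlc.exhibitsPoint p, ?_, ?_⟩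
    · have := hV.ideal.iso
      exact (locOpen _).prop_of_iso ((α_ _ _ _).symm ≪≫ e)
        (hV.prop_tensor (hT.localUnit (hlc.lower p) ⊗ x))
    · refine (locOpen _).rightOrthogonal.prop_of_iso
        ((α_ _ _ _).symm ≪≫ whiskerRightIso (β_ _ _) x ≪≫ e)
        (hU.rightOrthogonal_tensor (hT.gammaUnit (hlc.upper p) ⊗ x))

theorem isLocalisingIdeal_inf {S S' : ObjectProperty T} (hS : IsLocalisingIdeal S)
    (hS' : IsLocalisingIdeal S') : IsLocalisingIdeal (S ⊓ S') :=
  ⟨hS.toIsLocalising.inf hS'.toIsLocalising,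
    fun x y hy => ⟨hS.tensor x y hy.1, hS'.tensor x y hy.2⟩⟩

include hT hlc in
theorem isLocalisingIdeal_stratum (p : Spc T) : IsLocalisingIdeal (stratum p) := by
  -- Closure properties are not visible with `U` and `V` varying from object to object; idempotence
  -- allows a single fixed pair.
  have h : stratum p = locOpen (hlc.upper p) ⊓
      (locOpen (hlc.lower p)).rightOrthogonal := by
    ext x
    refine ⟨fun hx => ?_, fun hx => ⟨_, _, hlc.exhibitsPoint p, hx.1, hx.2⟩⟩
    have hV := hT.isIdempotentTriangle (hlc.upper p)
    have hU := hT.isIdempotentTriangle (hlc.lower p)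
    obtain ⟨e⟩ := (hT.stratum_iff hlc p x).1 hx
    have hVI := isLocalisingIdeal_inf hV.ideal hU.ideal_orthogonal
    have := hVI.iso
    refine ObjectProperty.prop_of_iso _ (β_ x _ ≪≫ e) (hVI.tensor _ _ ⟨hV.prop_tensor _, ?_⟩)
    exact hU.ideal_orthogonal.tensor _ _ hU.triangle.2.1
  rw [h]
  exact isLocalisingIdeal_inf (hT.isIdempotentTriangle _).ideal
    (hT.isIdempotentTriangle _).ideal_orthogonal

theorem not_isZero_gammaPoint (p : Spc T) : ¬ IsZero (hT.gammaPoint hlc p) :=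
  hT.not_isZero_gammaLocal (hlc.exhibitsPoint p)

theorem isZero_gammaPoint_tensor {p q : Spc T} (h : p ≠ q) :
    IsZero (hT.gammaPoint hlc p ⊗ hT.gammaPoint hlc q) :=
  hT.isZero_gammaLocal_tensor h (hlc.exhibitsPoint p) (hlc.exhibitsPoint q)

theorem nonempty_gammaPoint_iso (p : Spc T) :
    Nonempty (hT.gammaPoint hlc p ⊗ hT.gammaPoint hlc p ≅ hT.gammaPoint hlc p) := by
  rw [← toSkeleton_eq_toSkeleton_iff, Skeleton.toSkeleton_tensorObj]
  exact hT.toSkeleton_gammaLocal_mul (hlc.exhibitsPoint p) (hlc.exhibitsPoint p)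

theorem stratum_gammaPoint_tensor (p : Spc T) (x : T) :
    stratum p (hT.gammaPoint hlc p ⊗ x) := by
  obtain ⟨e⟩ := hT.nonempty_gammaPoint_iso hlc p
  exact (hT.stratum_iff hlc p _).2 ⟨(α_ _ _ _).symm ≪≫ whiskerRightIso e x⟩

end IsRigidlyCompactlyGenerated

end TensorTriangulated

/-! ### Supports of ideals and stratification. -/

section TensorTriangulated

variable {T : Type u} [Category.{v} T] [HasZeroObject T] [Preadditive T] [HasShift T ℤ]
  [∀ n : ℤ, (shiftFunctor T n).Additive] [Pretriangulated T] [IsTriangulated T]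
  [HasCoproducts.{v} T] [MonoidalCategory T] [SymmetricCategory T] [MonoidalClosed T]

theorem isLocalisingIdeal_locTensor (x : T) : IsLocalisingIdeal (locTensor x) := by
  have h := IsLocalising.sInf (A := {S : ObjectProperty T | IsLocalisingIdeal S ∧ S x})
    fun S hS => hS.1.toIsLocalising
  have h' : locTensor x = fun y => ∀ S ∈ {S : ObjectProperty T | IsLocalisingIdeal S ∧ S x},
      S y := by
    ext y
    exact ⟨fun h S hS => h S hS.1 hS.2, fun h S hS hX => h S ⟨hS, hX⟩⟩
  rw [← h'] at h
  exact ⟨h, fun a b hb S hS hx => hS.tensor a b (hb S hS hx)⟩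

theorem locTensor_self (x : T) : locTensor x x := fun _ _ h => h

theorem locTensor_le {S : ObjectProperty T} (hS : IsLocalisingIdeal S) {x : T} (hx : S x) :
    locTensor x ≤ S := fun _ hy => hy S hS hx

namespace IsRigidlyCompactlyGenerated

variable (hT : IsRigidlyCompactlyGenerated T) (hlc : PointsLocallyClosed T)
include hT

theorem isLocalisingIdeal_isZero_tensor (z : T) :
    IsLocalisingIdeal fun x : T => IsZero (z ⊗ x) :=
  ⟨hT.isLocalising_tensorLeft isLocalising_isZero z, fun x _ hy =>
    (hT.isZero_tensor_right x hy).of_iso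
      ((α_ _ _ _).symm ≪≫ whiskerRightIso (β_ _ _) _ ≪≫ α_ _ _ _)⟩

include hlc

theorem supp_subset_of_locTensor {x y : T} (h : locTensor y x) : supp x ⊆ supp y := by
  intro p hp
  rw [hT.mem_supp_iff hlc] at hp ⊢
  exact fun h0 => hp (h _ (hT.isLocalisingIdeal_isZero_tensor _) h0)

/-- The witness is the coproduct of one object of `S` per point of `A`; each summand is a retract,
so its support persists. -/
theorem exists_subset_supp {S : ObjectProperty T} (hS : IsLocalisingIdeal S)
    (A : Set (Spc T)) (hA : ∀ p ∈ A, ∃ x, S x ∧ p ∈ supp x) : ∃ y, S y ∧ A ⊆ supp y := by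
  classical
  have := hT.small_spc
  choose x hx hxp using hA
  let z : Shrink.{v} A → T := fun i => x _ ((equivShrink A).symm i).2
  refine ⟨∐ z, hS.coprod _ z fun i => hx _ _, fun p hp => ?_⟩
  have hr : Retract (x p hp) (∐ z) := by
    have : x p hp = z (equivShrink A ⟨p, hp⟩) := by simp [z]
    rw [this]
    exact ⟨Sigma.ι z _, Sigma.π z _, Sigma.ι_π_eq_id z _⟩
  have h := hxp p hp
  rw [hT.mem_supp_iff hlc] at h ⊢
  exact fun h0 => h (ObjectProperty.prop_of_retract (fun x : T => IsZero x)
    (hr.map (tensorLeft (hT.gammaPoint hlc p))) h0)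

theorem gammaPoint_tensor_mem {S : ObjectProperty T} (hS : IsLocalisingIdeal S) {x y : T}
    {p : Spc T} (hx : S x) (h : IsLocalCohomology p x y) : S y := by
  obtain ⟨e⟩ := (hT.isLocalCohomology_iff hlc p x y).1 h
  have := hS.iso
  exact S.prop_of_iso e.symm (hS.tensor _ x hx)

/-- The join is taken among localising subcategories; it is an ideal because `x ⊗ Γ_p w ≅ Γ_p (x ⊗
w)`. -/
theorem isLocalisingIdeal_loc_gammaIdeal {S : ObjectProperty T} (hS : IsLocalisingIdeal S) :
    IsLocalisingIdeal (loc (⨆ p : Spc T, gammaIdeal p S)) := by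
  refine ⟨isLocalising_loc _, fun x y hy => ?_⟩
  refine loc_le (hT.isLocalising_tensorLeft (isLocalising_loc _) x) (fun z hz => ?_) y hy
  obtain ⟨p, w, hw, hz⟩ := (ObjectProperty.prop_iSup_iff _ _).1 hz
  refine le_loc _ _ ((ObjectProperty.prop_iSup_iff _ _).2 ⟨p, x ⊗ w, hS.tensor x w hw, ?_⟩)
  obtain ⟨e⟩ := (hT.isLocalCohomology_iff hlc p _ _).1 hz
  exact (hT.isLocalCohomology_iff hlc p _ _).2 ⟨whiskerLeftIso x e ≪≫
    (α_ _ _ _).symm ≪≫ whiskerRightIso (β_ _ _) _ ≪≫ α_ _ _ _⟩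

theorem stratum_of_isLocalCohomology {p : Spc T} {x y : T} (h : IsLocalCohomology p x y) :
    stratum p y :=
  hT.gammaPoint_tensor_mem hlc (hT.isLocalisingIdeal_stratum hlc p)
    (x := hT.gammaPoint hlc p ⊗ x) (hT.stratum_gammaPoint_tensor hlc p x) <| by
    obtain ⟨e⟩ := (hT.isLocalCohomology_iff hlc p _ _).1 h
    obtain ⟨e'⟩ := hT.nonempty_gammaPoint_iso hlc p
    exact (hT.isLocalCohomology_iff hlc p _ _).2
      ⟨e ≪≫ whiskerRightIso e'.symm x ≪≫ α_ _ _ _⟩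

theorem supp_subset_of_stratum {p : Spc T} {x : T} (hx : stratum p x) : supp x ⊆ {p} := by
  intro q hq
  by_contra hqp
  rw [hT.mem_supp_iff hlc] at hq
  obtain ⟨e⟩ := (hT.stratum_iff hlc p x).1 hx
  exact hq ((hT.isZero_tensor_left (hT.isZero_gammaPoint_tensor hlc hqp) x).of_iso
    (whiskerLeftIso _ e.symm ≪≫ (α_ _ _ _).symm))

theorem mem_supp_of_stratum {p : Spc T} {x : T} (hx : stratum p x) (h0 : ¬ IsZero x) :
    p ∈ supp x := by
  rw [hT.mem_supp_iff hlc]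
  obtain ⟨e⟩ := (hT.stratum_iff hlc p x).1 hx
  exact fun h => h0 (h.of_iso e.symm)

theorem stratum_gammaPoint (p : Spc T) : stratum p (hT.gammaPoint hlc p) :=
  (hT.stratum_iff hlc p _).2 (hT.nonempty_gammaPoint_iso hlc p)

/-- In a stratified category the support detects containment of principal ideals. -/
theorem locTensor_le_of_isStratified (h : IsStratified T) {x y : T}
    (hxy : supp x ⊆ supp y) : locTensor x ≤ locTensor y := by
  have hx := isLocalisingIdeal_locTensor x
  have hy := isLocalisingIdeal_locTensor y
  rw [h.1 (locTensor x) hx]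
  refine loc_le hy.toIsLocalising fun z hz => ?_
  obtain ⟨p, w, hw, hz⟩ := (ObjectProperty.prop_iSup_iff _ _).1 hz
  by_cases hz0 : IsZero z
  · have := hy.triangulated
    have := hy.iso
    exact (locTensor y).prop_of_isZero hz0
  have hp : p ∈ supp y := hxy (hT.supp_subset_of_locTensor hlc hw ⟨z, hz, hz0⟩)
  -- This ideal contains `Γ_p y ≠ 0`, so minimality makes it the whole stratum, which contains `z`.
  rcases h.2 p (locTensor y ⊓ stratum p)
    (isLocalisingIdeal_inf hy (hT.isLocalisingIdeal_stratum hlc p)) inf_le_right with h0 | h1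
  · obtain ⟨w', hw', hw0⟩ := hp
    exact (hw0 (h0 w' ⟨hT.gammaPoint_tensor_mem hlc hy (locTensor_self y) hw',
      hT.stratum_of_isLocalCohomology hlc hw'⟩)).elim
  · have : stratum p z := hT.stratum_of_isLocalCohomology hlc hz
    rw [← h1] at this
    exact this.1

theorem isStratified_of_locTensor_le
    (h : ∀ x y : T, supp x ⊆ supp y → locTensor x ≤ locTensor y) : IsStratified T := by
  constructor
  · intro S hS
    have hΓ := hT.isLocalisingIdeal_loc_gammaIdeal hlc hS
    refine le_antisymm (fun x hx => ?_) (loc_le hS.toIsLocalising fun z hz => ?_)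
    · obtain ⟨y, hy, hsub⟩ := hT.exists_subset_supp hlc hΓ (supp x) fun p hp => by
        obtain ⟨z, hz, hz0⟩ := hp
        exact ⟨z, le_loc _ _ ((ObjectProperty.prop_iSup_iff _ _).2 ⟨p, x, hx, hz⟩),
          hT.mem_supp_of_stratum hlc (hT.stratum_of_isLocalCohomology hlc hz) hz0⟩
      exact locTensor_le hΓ hy x (h x y hsub x (locTensor_self x))
    · obtain ⟨p, w, hw, hz⟩ := (ObjectProperty.prop_iSup_iff _ _).1 hz
      exact hT.gammaPoint_tensor_mem hlc hS hw hz
  · intro p S hS hSp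
    by_cases h0 : ∀ x, S x → IsZero x
    · exact Or.inl h0
    · push Not at h0
      obtain ⟨x, hx, hx0⟩ := h0
      refine Or.inr (le_antisymm hSp fun y hy => ?_)
      have hsub : supp y ⊆ supp x := (hT.supp_subset_of_stratum hlc hy).trans
        (Set.singleton_subset_iff.2 (hT.mem_supp_of_stratum hlc (hSp x hx) hx0))
      exact locTensor_le hS hx y (h y x hsub y (locTensor_self y))

theorem suppIdeal_locTensor (x : T) :
    suppIdeal ⟨locTensor x, isLocalisingIdeal_locTensor x⟩ = supp x :=
  Set.Subset.antisymm (fun _ ⟨_, hy, hp⟩ => hT.supp_subset_of_locTensor hlc hy hp)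
    fun _ hp => ⟨x, locTensor_self x, hp⟩

/-- The ideal generated by the `Γ_q 𝟙` with `q ∈ A` works: for `p ∉ A`, orthogonality puts every
generator in the ideal annihilated by `Γ_p 𝟙`. -/
theorem exists_suppIdeal_eq (A : Set (Spc T)) : ∃ S : LocIdeal T, suppIdeal S = A := by
  have hS : IsLocalisingIdeal fun x : T => ∀ S ∈ {S : ObjectProperty T | IsLocalisingIdeal S ∧
      ∀ p ∈ A, S (hT.gammaPoint hlc p)}, S x :=
    ⟨IsLocalising.sInf fun S hS => hS.1.toIsLocalising,
      fun x y hy S hS => hS.1.tensor x y (hy S hS)⟩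
  refine ⟨⟨_, hS⟩, Set.Subset.antisymm ?_ fun p hp => ⟨hT.gammaPoint hlc p,
    fun S hS => hS.2 p hp, hT.mem_supp_of_stratum hlc (hT.stratum_gammaPoint hlc p)
      (hT.not_isZero_gammaPoint hlc p)⟩⟩
  rintro p ⟨x, hx, hp⟩
  by_contra hpA
  rw [hT.mem_supp_iff hlc] at hp
  exact hp (hx _ ⟨hT.isLocalisingIdeal_isZero_tensor _, fun q hq =>
    hT.isZero_gammaPoint_tensor hlc fun h : p = q => hpA (h ▸ hq)⟩)

theorem suppIdeal_le_iff (h : ∀ x y : T, supp x ⊆ supp y → locTensor x ≤ locTensor y)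
    (S S' : LocIdeal T) : suppIdeal S ≤ suppIdeal S' ↔ S ≤ S' := by
  refine ⟨fun hle x hx => ?_, fun hle p ⟨x, hx, hp⟩ => ⟨x, hle x hx, hp⟩⟩
  obtain ⟨y, hy, hsub⟩ := hT.exists_subset_supp hlc S'.2 (supp x)
    fun p hp => hle ⟨x, hx, hp⟩
  exact locTensor_le S'.2 hy x (h x y hsub x (locTensor_self x))

end IsRigidlyCompactlyGenerated

end TensorTriangulated

end TTG

theorem mainTheorem11 (T : Type u) [Category.{v} T] [HasZeroObject T] [Preadditive T]
    [HasShift T ℤ] [∀ n : ℤ, (shiftFunctor T n).Additive] [Pretriangulated T] [IsTriangulated T]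
    [HasCoproducts.{v} T] [MonoidalCategory T] [SymmetricCategory T] [MonoidalClosed T]
    (hT : TTG.IsRigidlyCompactlyGenerated T) (hlc : TTG.PointsLocallyClosed T) :
    List.TFAE
      [TTG.IsStratified T,
       ∃ e : TTG.LocIdeal T ≃o Set (TTG.Spc T), ∀ S : TTG.LocIdeal T, e S = TTG.suppIdeal S,
       ∀ x y : T, TTG.supp x ⊆ TTG.supp y → TTG.locTensor x ≤ TTG.locTensor y] := by
  tfae_have 1 → 3 := fun h _ _ => hT.locTensor_le_of_isStratified hlc h
  tfae_have 3 → 1 := hT.isStratified_of_locTensor_le hlc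
  tfae_have 3 → 2 := fun h =>
    let f : TTG.LocIdeal T ↪o Set (TTG.Spc T) :=
      OrderEmbedding.ofMapLEIff TTG.suppIdeal (hT.suppIdeal_le_iff hlc h)
    ⟨RelIso.ofSurjective f (hT.exists_suppIdeal_eq hlc), fun _ => rfl⟩
  tfae_have 2 → 3 := by
    rintro ⟨e, he⟩ x y hxy
    have := e.le_iff_le (x := ⟨_, TTG.isLocalisingIdeal_locTensor x⟩)
      (y := ⟨_, TTG.isLocalisingIdeal_locTensor y⟩)
    rw [he, he, hT.suppIdeal_locTensor hlc, hT.suppIdeal_locTensor hlc] at this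
    exact this.1 hxy
  tfae_finish
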